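/- Let $S$ be a compact oriented smooth surface in $\mathbb R^3$ with (possibly empty) smooth boundary $\partial S$, that is, a compact oriented smooth two-dimensional manifold with boundary together with a smooth immersion $\mathbf r:S\to\mathbb R^3$ as its position vector (for an embedded surface, the inclusion). Let $\mathbf z:S\to\mathbb R^3$ be an infinitesimal bending of $S$, i.e. a smooth vector field such that, in local parameters $(u,v)$, $$\mathbf r_u\cdot\mathbf z_u=0,\qquad \mathbf r_u\cdot\mathbf z_v+\mathbf r_v\cdot\mathbf z_u=0,\qquad \mathbf r_v\cdot\mathbf z_v=0,$$ and let $\mathbf y:S\to\mathbb R^3$ be its rotation field, i.e. the vector field determined by $d\mathbf z=\mathbf y\times d\mathbf r$. For an oriented surface let $$H=\int\tfrac12(\kappa_1+\kappa_2)\,dS$$ denote the total mean curvature, where $\kappa_1,\kappa_2$ are the principal curvatures with respect to the unit normal $\mathbf n=\mathbf r_u\times\mathbf r_v/|\mathbf r_u\times\mathbf r_v|$ in positively oriented parameters (the second fundamental form being $d^2\mathbf r\cdot\mathbf n$). Let $S_t$ be the surface with position vector $\mathbf r+t\mathbf z$ and the orientation of $S$. Then $t\mapsto H(S_t)$ is differentiable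 at $t=0$, and the variation $H'(S)=\frac{d}{dt}\big|_{t=0}H(S_t)$ of the total mean curvature is $$H'(S)=-\frac12\oint_{\partial S}\mathbf y\cdot d\mathbf r,$$ where $\partial S$ carries the orientation compatible with that of $S$. -/

import Mathlib

open Set MeasureTheory Matrix
open scoped Manifold ContDiff

noncomputable section

namespace SurfaceBending

/-- The parameter plane, with coordinates `u = x 0` and `v = x 1`. -/
abbrev Plane : Type := EuclideanSpace ℝ (Fin 2)

/-- Three-space. Only its smooth structure, the standard inner product `a ⬝ᵥ b` and the cross product
`a ⨯₃ b` are used, never the (sup) norm of the function type. -/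
abbrev Space : Type := Fin 3 → ℝ

/-- The partial derivative of `φ` in the `k`-th coordinate direction, for a map `φ` that is
considered on the closed half-plane `{x | 0 ≤ x 0}` only (one-sided on the edge). -/
def partialDeriv (k : Fin 2) (φ : Plane → Space) (x : Plane) : Space :=
  fderivWithin ℝ φ (range (𝓡∂ 2)) x (EuclideanSpace.single k (1 : ℝ))

/-! ### Classical surface theory of a local parametrization `φ = φ (u, v)` -/

/-- `φ_u × φ_v`. -/
def normalVec (φ : Plane → Space) (x : Plane) : Space :=
  partialDeriv 0 φ x ⨯₃ partialDeriv 1 φ x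

/-- The area element `|φ_u × φ_v|`, the density of `dS` with respect to `du dv`. -/
def areaElement (φ : Plane → Space) (x : Plane) : ℝ :=
  √(normalVec φ x ⬝ᵥ normalVec φ x)

/-- The unit normal `φ_u × φ_v / |φ_u × φ_v|`. -/
def unitNormal (φ : Plane → Space) (x : Plane) : Space :=
  (areaElement φ x)⁻¹ • normalVec φ x

/-- The matrix of the first fundamental form. -/
def firstForm (φ : Plane → Space) (x : Plane) : Matrix (Fin 2) (Fin 2) ℝ :=
  Matrix.of fun j k => partialDeriv j φ x ⬝ᵥ partialDeriv k φ x

/-- The matrix of the second fundamental form, with respect to the unit normal above. -/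
def secondForm (φ : Plane → Space) (x : Plane) : Matrix (Fin 2) (Fin 2) ℝ :=
  Matrix.of fun j k => partialDeriv j (partialDeriv k φ) x ⬝ᵥ unitNormal φ x

/-- The principal curvatures `κ₁, κ₂`: the eigenvalues, counted with multiplicity, of the second
fundamental form relative to the first one (that is, of the shape operator). -/
def principalCurvatures (φ : Plane → Space) (x : Plane) : Multiset ℝ :=
  ((firstForm φ x)⁻¹ * secondForm φ x).charpoly.roots

/-- The mean curvature `(κ₁ + κ₂) / 2`. -/
def meanCurvature (φ : Plane → Space) (x : Plane) : ℝ :=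
  (1 / 2) * (principalCurvatures φ x).sum

/-! ### Oriented surfaces with boundary -/

section Surface

variable (M : Type*) [TopologicalSpace M] [ChartedSpace (EuclideanHalfSpace 2) M]

/-- The atlas of the surface is oriented: all its changes of coordinates have a positive Jacobian.
Its charts are then the positively oriented ones. -/
def IsOrientedAtlas : Prop :=
  ∀ e ∈ atlas (EuclideanHalfSpace 2) M, ∀ e' ∈ atlas (EuclideanHalfSpace 2) M,
    ∀ p ∈ e.source ∩ e'.source,
      0 < (fderivWithin ℝ (e'.extend (𝓡∂ 2) ∘ (e.extend (𝓡∂ 2)).symm) (range (𝓡∂ 2))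
        (e.extend (𝓡∂ 2) p)).det

/-- A smooth partition of unity on the compact surface `M`, subordinate to the cover of `M` by its
charts: the `i`-th function has its support inside the domain of the chart at `i`, and all but
finitely many of the functions vanish. -/
def chartPartition [T2Space M] [CompactSpace M] [IsManifold (𝓡∂ 2) ∞ M] :
    SmoothPartitionOfUnity M (𝓡∂ 2) M univ :=
  (SmoothPartitionOfUnity.exists_isSubordinate_chartAt_source (𝓡∂ 2) M).choose

variable {M}

/-- The map `f` in the coordinates `(u, v)` of the chart at `i`. -/
def inChart {X : Type*} (f : M → X) (i : M) : Plane → X :=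
  f ∘ (extChartAt (𝓡∂ 2) i).symm

/-- The differential of a vector-valued map on the surface. -/
def diff (f : M → Space) (p : M) : TangentSpace (𝓡∂ 2) p →L[ℝ] Space :=
  mfderiv (𝓡∂ 2) 𝓘(ℝ, Space) f p

/-- `r` is a smooth immersion of the surface into three-space. -/
def IsSmoothImmersion (r : M → Space) : Prop :=
  ContMDiff (𝓡∂ 2) 𝓘(ℝ, Space) ∞ r ∧ ∀ p, Function.Injective (diff r p)

/-- `z` is an infinitesimal bending of the surface with position vector `r`: it is smooth, and
`dr · dz = 0` as a quadratic form, that is `r_u · z_u = 0`, `r_u · z_v + r_v · z_u = 0` and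
`r_v · z_v = 0` in local parameters. -/
def IsInfinitesimalBending (r z : M → Space) : Prop :=
  ContMDiff (𝓡∂ 2) 𝓘(ℝ, Space) ∞ z ∧
    ∀ (p : M) (a b : TangentSpace (𝓡∂ 2) p),
      diff r p a ⬝ᵥ diff z p b + diff r p b ⬝ᵥ diff z p a = 0

/-- `y` is the rotation field of the surface under `z`: `dz = y × dr`. -/
def IsRotationField (r z y : M → Space) : Prop :=
  ∀ (p : M) (a : TangentSpace (𝓡∂ 2) p), diff z p a = y p ⨯₃ diff r p a

variable [T2Space M] [CompactSpace M] [IsManifold (𝓡∂ 2) ∞ M]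

/-- The total mean curvature `∫ (κ₁ + κ₂) / 2 dS` of the surface with position vector `r`. -/
def totalMeanCurvature (r : M → Space) : ℝ :=
  ∑ᶠ i : M, ∫ x in (extChartAt (𝓡∂ 2) i).target,
    inChart (chartPartition M i) i x *
      (meanCurvature (inChart r i) x * areaElement (inChart r i) x)

/-- The line integral `∮ y · dr` over the boundary of the surface with position vector `r`. In a
chart the surface is the side `u ≥ 0` of the boundary line `u = 0`, so that the direction compatible
with the orientation (surface on the left) is that of decreasing `v`; hence the sign. -/
def boundaryLineIntegral (r y : M → Space) : ℝ :=
  ∑ᶠ i : M, -∫ v in {v : ℝ | !₂[0, v] ∈ (extChartAt (𝓡∂ 2) i).target},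
    inChart (chartPartition M i) i !₂[0, v] *
      (inChart y i !₂[0, v] ⬝ᵥ partialDeriv 1 (inChart r i) !₂[0, v])

end Surface

end SurfaceBending

end

noncomputable section

namespace SurfaceBending

/-! ### Algebra of the mean curvature -/

/-! In local parameters the two square roots in `H dS`, one from the unit normal and one from the
area element, cancel. So `H dS` is a rational function of the first and second partial derivatives
of `r`, smooth wherever `r_u × r_v ≠ 0` (`meanCurvature_mul_areaElement`).

Under the bending, first derivatives vary by `y × r_u`, `y × r_v`, and second ones by `y × r_uu +
y_u × r_u` and so on. The `y ×` terms are an infinitesimal rotation and leave the density unchanged.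
What remains collapses, by Lagrange's identity, to `-(1/2) (y_u · r_v - y_v · r_u) du dv = -(1/2)
d(y · dr)` (`hasDerivAt_curvatureDensity`). The theorem is then Stokes' formula for the one-form `y
· dr`.

To globalize, each weight `ρ` of the partition of unity is carried through Stokes in its own chart,
`ρ d(y · dr) = d(ρ y · dr) - dρ ∧ (y · dr)` (`setIntegral_mul_curl`). The first terms add up to the
boundary integral. The second ones cancel in total because the weights sum to `1` and the form `dρ ∧
(y · dr)` has the same integral in all positively oriented charts (`sum_setIntegral_wedgeDensity`).
The field `y` is smooth because `dz = y × dr` can be solved for it algebraically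
(`contDiffOn_inChart_rotation`). -/

theorem sum_roots_charpoly_fin_two (A : Matrix (Fin 2) (Fin 2) ℝ)
    (h : 0 ≤ A.trace ^ 2 - 4 * A.det) : A.charpoly.roots.sum = A.trace := by
  have hs := Real.sq_sqrt h
  set s := √(A.trace ^ 2 - 4 * A.det) with hsdef
  have hfac : A.charpoly = (Polynomial.X - Polynomial.C ((A.trace + s) / 2)) *
      (Polynomial.X - Polynomial.C ((A.trace - s) / 2)) := by
    have h1 : A.trace = (A.trace + s) / 2 + (A.trace - s) / 2 := by ring
    have h2 : A.det = (A.trace + s) / 2 * ((A.trace - s) / 2) := by nlinarith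
    rw [Matrix.charpoly_fin_two]
    conv_lhs => rw [h1, h2]
    rw [Polynomial.C_add, Polynomial.C_mul]
    ring
  rw [hfac, Polynomial.roots_mul (mul_ne_zero (Polynomial.X_sub_C_ne_zero _)
    (Polynomial.X_sub_C_ne_zero _)), Polynomial.roots_X_sub_C, Polynomial.roots_X_sub_C]
  simp
  ring

/-- `roots` sees real eigenvalues only, so their sum is the trace only once the discriminant is
known to be nonnegative. This holds because the first form is positive definite and the second
symmetric. -/
theorem sum_roots_charpoly_inv_mul {E F G e f g : ℝ} (hE : 0 < E) (hD : 0 < E * G - F * F) :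
    ((!![E, F; F, G])⁻¹ * !![e, f; f, g]).charpoly.roots.sum =
      (G * e - 2 * F * f + E * g) / (E * G - F * F) := by
  have hinv : (!![E, F; F, G])⁻¹ * !![e, f; f, g] =
      (E * G - F * F)⁻¹ • !![G * e - F * f, G * f - F * g; E * f - F * e, E * g - F * f] := by
    rw [Matrix.inv_def, Matrix.det_fin_two_of, Matrix.adjugate_fin_two_of, Ring.inverse_eq_inv',
      Matrix.smul_mul]
    congr 1
    ext i j
    fin_cases i <;> fin_cases j <;> simp [Matrix.mul_apply, Fin.sum_univ_two] <;> ring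
  have htr : ((!![E, F; F, G])⁻¹ * !![e, f; f, g]).trace =
      (G * e - 2 * F * f + E * g) / (E * G - F * F) := by
    rw [hinv, Matrix.trace_smul, Matrix.trace_fin_two_of, smul_eq_mul]
    field_simp
    ring
  have hdet : ((!![E, F; F, G])⁻¹ * !![e, f; f, g]).det =
      (e * g - f * f) / (E * G - F * F) := by
    have hp : (G * e - F * f) * (E * g - F * f) - (G * f - F * g) * (E * f - F * e) =
        (E * G - F * F) * (e * g - f * f) := by ring
    rw [hinv, Matrix.det_smul, Matrix.det_fin_two_of, Fintype.card_fin, hp]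
    generalize E * G - F * F = D at hD
    field_simp
  rw [sum_roots_charpoly_fin_two _ ?_, htr]
  rw [htr, hdet]
  -- Sum-of-squares certificate for the discriminant; its numerator is nonnegative since `E * G - F
  -- * F > 0`.
  have key : ((G * e - 2 * F * f + E * g) / (E * G - F * F)) ^ 2
      - 4 * ((e * g - f * f) / (E * G - F * F)) =
      ((E * (E * g - G * e) - 2 * F * (E * f - F * e)) ^ 2
        + 4 * (E * G - F * F) * (E * f - F * e) ^ 2) / (E * (E * G - F * F)) ^ 2 := by
    have hD' : E * G - F * F ≠ 0 := hD.ne'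
    field_simp
    ring
  rw [key]
  positivity

/-- The numerator of twice the mean curvature density, as a function of the first partial
derivatives `a`, `b` and the second ones `c`, `m`, `d`. -/
def curvatureNumerator (a b c m m' d : Space) : ℝ :=
  (b ⬝ᵥ b) * (c ⬝ᵥ (a ⨯₃ b)) - (a ⬝ᵥ b) * (m ⬝ᵥ (a ⨯₃ b) + m' ⬝ᵥ (a ⨯₃ b))
    + (a ⬝ᵥ a) * (d ⬝ᵥ (a ⨯₃ b))

/-- `H dA` as a rational function of the first and second partial derivatives. -/
def curvatureDensity (a b c m m' d : Space) : ℝ :=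
  curvatureNumerator a b c m m' d / (2 * ((a ⨯₃ b) ⬝ᵥ (a ⨯₃ b)))

theorem dotProduct_self_pos {a : Space} (h : a ≠ 0) : 0 < a ⬝ᵥ a :=
  lt_of_le_of_ne (Finset.sum_nonneg fun _ _ => mul_self_nonneg _)
    (fun h' => h (dotProduct_self_eq_zero.1 h'.symm))

/-- The factor `1 / |N|` in the second form cancels against the area element, up to `|N|²`. The
symmetry `hs` makes the second form symmetric and allows `m + m'` in place of `2 m`. -/
theorem meanCurvature_mul_areaElement {φ : Plane → Space} {x : Plane} (h : normalVec φ x ≠ 0)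
    (hs : partialDeriv 0 (partialDeriv 1 φ) x = partialDeriv 1 (partialDeriv 0 φ) x) :
    meanCurvature φ x * areaElement φ x =
      curvatureDensity (partialDeriv 0 φ x) (partialDeriv 1 φ x)
        (partialDeriv 0 (partialDeriv 0 φ) x) (partialDeriv 0 (partialDeriv 1 φ) x)
        (partialDeriv 1 (partialDeriv 0 φ) x) (partialDeriv 1 (partialDeriv 1 φ) x) := by
  have hN := dotProduct_self_pos h
  have ha : partialDeriv 0 φ x ≠ 0 := by
    intro h0; apply h; simp [normalVec, h0]
  have hE := dotProduct_self_pos ha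
  have hW : 0 < areaElement φ x := Real.sqrt_pos.2 hN
  have hW2 : areaElement φ x ^ 2 = normalVec φ x ⬝ᵥ normalVec φ x := Real.sq_sqrt hN.le
  have hL : normalVec φ x ⬝ᵥ normalVec φ x =
      (partialDeriv 0 φ x ⬝ᵥ partialDeriv 0 φ x) * (partialDeriv 1 φ x ⬝ᵥ partialDeriv 1 φ x)
       - (partialDeriv 0 φ x ⬝ᵥ partialDeriv 1 φ x) *
         (partialDeriv 0 φ x ⬝ᵥ partialDeriv 1 φ x) := by
    simp only [normalVec, cross_dot_cross, dotProduct_comm (partialDeriv 1 φ x)]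
  have hg : firstForm φ x = !![partialDeriv 0 φ x ⬝ᵥ partialDeriv 0 φ x,
      partialDeriv 0 φ x ⬝ᵥ partialDeriv 1 φ x;
      partialDeriv 0 φ x ⬝ᵥ partialDeriv 1 φ x, partialDeriv 1 φ x ⬝ᵥ partialDeriv 1 φ x] := by
    ext i j
    fin_cases i <;> fin_cases j <;> simp [firstForm, dotProduct_comm]
  have hh : secondForm φ x = !![partialDeriv 0 (partialDeriv 0 φ) x ⬝ᵥ unitNormal φ x,
      partialDeriv 0 (partialDeriv 1 φ) x ⬝ᵥ unitNormal φ x;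
      partialDeriv 0 (partialDeriv 1 φ) x ⬝ᵥ unitNormal φ x,
      partialDeriv 1 (partialDeriv 1 φ) x ⬝ᵥ unitNormal φ x] := by
    ext i j
    fin_cases i <;> fin_cases j <;> simp [secondForm, hs]
  rw [meanCurvature, principalCurvatures, hg, hh,
    sum_roots_charpoly_inv_mul hE (by rw [← hL]; exact hN), ← hL, curvatureDensity,
    curvatureNumerator, ← hs]
  change _ = _ / (2 * (normalVec φ x ⬝ᵥ normalVec φ x))
  simp only [unitNormal, dotProduct_smul, smul_eq_mul]
  rw [← hW2]
  simp only [normalVec]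
  field_simp
  ring

/-! ### The variation of the mean curvature density -/

theorem hasDerivAt_dotProduct {f g : ℝ → Space} {f' g' : Space} {t : ℝ} (hf : HasDerivAt f f' t)
    (hg : HasDerivAt g g' t) :
    HasDerivAt (fun s => f s ⬝ᵥ g s) (f' ⬝ᵥ g t + f t ⬝ᵥ g') t := by
  have hf' := hasDerivAt_pi.1 hf
  have hg' := hasDerivAt_pi.1 hg
  simp only [dotProduct, ← Finset.sum_add_distrib]
  exact HasDerivAt.fun_sum fun i _ => (hf' i).mul (hg' i)

theorem hasDerivAt_crossProduct {f g : ℝ → Space} {f' g' : Space} {t : ℝ} (hf : HasDerivAt f f' t)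
    (hg : HasDerivAt g g' t) :
    HasDerivAt (fun s => f s ⨯₃ g s) (f' ⨯₃ g t + f t ⨯₃ g') t := by
  have hf' := hasDerivAt_pi.1 hf
  have hg' := hasDerivAt_pi.1 hg
  refine hasDerivAt_pi.2 fun i => ?_
  fin_cases i <;> simp [cross_apply]
  · convert ((hf' 1).fun_mul (hg' 2)).fun_sub ((hf' 2).fun_mul (hg' 1)) using 1; ring
  · convert ((hf' 2).fun_mul (hg' 0)).fun_sub ((hf' 0).fun_mul (hg' 2)) using 1; ring
  · convert ((hf' 0).fun_mul (hg' 1)).fun_sub ((hf' 1).fun_mul (hg' 0)) using 1; ring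

theorem hasDerivAt_add_smul_zero (a b : Space) : HasDerivAt (fun t : ℝ => a + t • b) b 0 := by
  simpa using ((hasDerivAt_id (0 : ℝ)).smul_const b).const_add a

/-- The variation of `H dA` when the first partial derivatives `a`, `b` vary by `y × a`, `y × b` and
the second ones by the derivatives of these fields. -/
theorem hasDerivAt_curvatureDensity (a b c m m' d y p q : Space) (h : a ⨯₃ b ≠ 0) :
    HasDerivAt (fun t : ℝ => curvatureDensity (a + t • (y ⨯₃ a)) (b + t • (y ⨯₃ b))
        (c + t • (p ⨯₃ a + y ⨯₃ c)) (m + t • (p ⨯₃ b + y ⨯₃ m))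
        (m' + t • (q ⨯₃ a + y ⨯₃ m')) (d + t • (q ⨯₃ b + y ⨯₃ d)))
      (-(1 / 2) * (p ⬝ᵥ b - q ⬝ᵥ a)) 0 := by
  have ha := hasDerivAt_add_smul_zero a (y ⨯₃ a)
  have hb := hasDerivAt_add_smul_zero b (y ⨯₃ b)
  have hN := hasDerivAt_crossProduct ha hb
  have hc := hasDerivAt_dotProduct (hasDerivAt_add_smul_zero c (p ⨯₃ a + y ⨯₃ c)) hN
  have hm := hasDerivAt_dotProduct (hasDerivAt_add_smul_zero m (p ⨯₃ b + y ⨯₃ m)) hN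
  have hm' := hasDerivAt_dotProduct (hasDerivAt_add_smul_zero m' (q ⨯₃ a + y ⨯₃ m')) hN
  have hd := hasDerivAt_dotProduct (hasDerivAt_add_smul_zero d (q ⨯₃ b + y ⨯₃ d)) hN
  have hNN := hasDerivAt_dotProduct hN hN
  have hD := (dotProduct_self_pos h).ne'
  have hq := (((hasDerivAt_dotProduct hb hb).fun_mul hc).fun_sub
    ((hasDerivAt_dotProduct ha hb).fun_mul (hm.fun_add hm'))).fun_add
    ((hasDerivAt_dotProduct ha ha).fun_mul hd)
  have := hq.fun_div (hNN.const_mul 2) (by simpa using h)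
  refine this.congr_deriv ?_
  simp only [zero_smul, add_zero]
  have hD2 : (2 * (a ⨯₃ b ⬝ᵥ a ⨯₃ b)) ^ 2 ≠ 0 := by positivity
  rw [div_eq_iff hD2]
  -- A polynomial identity in coordinates. The terms in `y` cancel, since dot and triple products
  -- are rotation invariant. With `(p × a) · (a × b) = (p · a)(a · b) - (p · b)(a · a)` and its
  -- analogues, the rest of the numerator's derivative is `-|a × b|² (p · b - q · a)`.
  simp only [cross_apply, dotProduct, Fin.sum_univ_three, Pi.add_apply, Matrix.cons_val]
  ring

/-- A rotation field in terms of the differentials of the surface and of the bending. -/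
theorem normal_sq_smul_rotation (a b y : Space) :
    ((a ⨯₃ b) ⬝ᵥ (a ⨯₃ b)) • y = ((y ⨯₃ a) ⬝ᵥ b) • (a ⨯₃ b) +
      (a ⨯₃ b) ⨯₃ ((y ⨯₃ a) ⨯₃ b + a ⨯₃ (y ⨯₃ b)) := by
  -- With `N = a × b`, the second summand is `N × (y × N) = |N|² y - (N · y) N`, and `(y × a) · b =
  -- N · y`.
  ext i
  fin_cases i <;>
  · simp [cross_apply, dotProduct, Fin.sum_univ_three]
    ring

/-! ### Calculus on the closed half-plane -/

theorem mem_halfPlane {x : Plane} : x ∈ range (𝓡∂ 2) ↔ 0 ≤ x 0 := by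
  rw [range_modelWithCornersEuclideanHalfSpace]; rfl

theorem isClosed_halfPlane : IsClosed (range (𝓡∂ 2)) :=
  (𝓡∂ 2).isClosed_range

theorem uniqueDiffOn_halfPlane : UniqueDiffOn ℝ (range (𝓡∂ 2)) :=
  (𝓡∂ 2).uniqueDiffOn

theorem halfPlane_mem_nhds {x : Plane} (hx : 0 < x 0) : range (𝓡∂ 2) ∈ nhds x := by
  have ho : IsOpen {y : Plane | 0 < y 0} := isOpen_lt continuous_const (by fun_prop)
  exact Filter.mem_of_superset (ho.mem_nhds hx) fun y hy => mem_halfPlane.2 (le_of_lt hy)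

/-- The pairs `(u, v)` as points of the parameter plane. -/
def planePoint (z : ℝ × ℝ) : Plane := !₂[z.1, z.2]

theorem planePoint_eq (u v : ℝ) : planePoint (u, v) =
    u • EuclideanSpace.single (0 : Fin 2) (1 : ℝ) + v • EuclideanSpace.single (1 : Fin 2) (1 : ℝ) := by
  ext i; fin_cases i <;> simp [planePoint]

theorem planePoint_zero (z : ℝ × ℝ) : planePoint z 0 = z.1 := rfl

/-- The parameter plane is the product of two lines, as a measure space. -/
def planeEquiv : (ℝ × ℝ) ≃ᵐ Plane :=
  MeasurableEquiv.finTwoArrow.symm.trans (MeasurableEquiv.toLp 2 (Fin 2 → ℝ))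

theorem planeEquiv_apply (z : ℝ × ℝ) : planeEquiv z = planePoint z := by
  ext i; fin_cases i <;> rfl

theorem measurePreserving_planeEquiv : MeasurePreserving planeEquiv volume volume :=
  (volume_preserving_finTwoArrow ℝ).symm.trans
    (EuclideanSpace.volume_preserving_symm_measurableEquiv_toLp (Fin 2)).symm

theorem planeEquiv_preimage_halfPlane :
    planeEquiv ⁻¹' range (𝓡∂ 2) = Ici (0 : ℝ) ×ˢ (univ : Set ℝ) := by
  ext z
  rw [mem_preimage, mem_halfPlane, planeEquiv_apply, planePoint_zero]
  simp

/-- The edge is a null set, so `u` may range over the open half-line, where derivatives within the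
half-plane are ordinary ones. -/
theorem setIntegral_halfPlane (g : Plane → ℝ) :
    ∫ x in range (𝓡∂ 2), g x =
      ∫ z, g (planePoint z) ∂((volume.restrict (Ioi (0 : ℝ))).prod (volume : Measure ℝ)) := by
  have h1 := measurePreserving_planeEquiv.setIntegral_preimage_emb
    planeEquiv.measurableEmbedding g (range (𝓡∂ 2))
  rw [← h1, planeEquiv_preimage_halfPlane, Measure.volume_eq_prod, ← Measure.prod_restrict,
    Measure.restrict_univ, restrict_Ioi_eq_restrict_Ici]
  simp only [planeEquiv_apply]

theorem integrable_halfPlane {g : Plane → ℝ} (hg : IntegrableOn g (range (𝓡∂ 2))) :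
    Integrable (fun z => g (planePoint z))
      ((volume.restrict (Ioi (0 : ℝ))).prod (volume : Measure ℝ)) := by
  have h1 := (measurePreserving_planeEquiv.integrableOn_comp_preimage
    planeEquiv.measurableEmbedding (s := range (𝓡∂ 2)) (f := g)).2 hg
  rw [planeEquiv_preimage_halfPlane, IntegrableOn, Measure.volume_eq_prod,
    ← Measure.prod_restrict, Measure.restrict_univ, ← restrict_Ioi_eq_restrict_Ici] at h1
  exact h1.congr (Filter.Eventually.of_forall fun z => by simp [planeEquiv_apply])

theorem fderivWithin_eq_zero_of_compl {V : Type*} [NormedAddCommGroup V] [NormedSpace ℝ V]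
    {f : Plane → V} {K : Set Plane} (hK : IsCompact K)
    (h0 : ∀ x ∈ range (𝓡∂ 2), x ∉ K → f x = 0) {x : Plane} (hx : x ∈ range (𝓡∂ 2)) (hxK : x ∉ K) :
    fderivWithin ℝ f (range (𝓡∂ 2)) x = 0 := by
  have : f =ᶠ[nhdsWithin x (range (𝓡∂ 2))] fun _ => 0 := by
    filter_upwards [self_mem_nhdsWithin,
      mem_nhdsWithin_of_mem_nhds (hK.isClosed.isOpen_compl.mem_nhds hxK)] with y hy hyK
    exact h0 y hy hyK
  rw [this.fderivWithin_eq (h0 x hx hxK)]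
  simp

/-- A function that is continuous on a set and vanishes there off a compact subset is integrable. -/
theorem integrableOn_of_continuousOn_of_compl {X : Type*} [TopologicalSpace X] [T2Space X]
    [MeasurableSpace X] [OpensMeasurableSpace X] {μ : Measure X} [IsFiniteMeasureOnCompacts μ]
    {g : X → ℝ} {K T : Set X} (hK : IsCompact K) (hT : MeasurableSet T) (hg : ContinuousOn g K)
    (h0 : ∀ x ∈ T, x ∉ K → g x = 0) : IntegrableOn g T μ :=
  (hg.integrableOn_compact' hK hK.measurableSet).of_forall_sdiff_eq_zero hT
    fun x hx => h0 x hx.1 hx.2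

theorem exists_bound_of_isCompact {K : Set Plane} (hK : IsCompact K) :
    ∃ R, ∀ x ∈ K, |x 0| ≤ R ∧ |x 1| ≤ R := by
  obtain ⟨R, hR⟩ := hK.isBounded.exists_norm_le
  exact ⟨R, fun x hx => ⟨(PiLp.norm_apply_le x 0).trans (hR x hx),
    (PiLp.norm_apply_le x 1).trans (hR x hx)⟩⟩

/-! ### Stokes' formula on the half-plane with compact support -/

section Stokes

variable {f : Plane → ℝ} {K : Set Plane} (hf : ContDiffOn ℝ 1 f (range (𝓡∂ 2)))
  (hK : IsCompact K) (hKH : K ⊆ range (𝓡∂ 2)) (h0 : ∀ x ∈ range (𝓡∂ 2), x ∉ K → f x = 0)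

include hf hK hKH h0

theorem integrableOn_fderivWithin_apply (w : Plane) :
    IntegrableOn (fun x => fderivWithin ℝ f (range (𝓡∂ 2)) x w) (range (𝓡∂ 2)) := by
  refine integrableOn_of_continuousOn_of_compl hK isClosed_halfPlane.measurableSet ?_ fun x hx hxK => by
    rw [fderivWithin_eq_zero_of_compl hK h0 hx hxK]; rfl
  exact ((hf.continuousOn_fderivWithin uniqueDiffOn_halfPlane le_rfl).clm_apply
    continuousOn_const).mono hKH

omit hK hKH h0 in
theorem hasDerivAt_line_fst {u v : ℝ} (hu : 0 < u) :
    HasDerivAt (fun s => f (planePoint (s, v))) (fderivWithin ℝ f (range (𝓡∂ 2))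
      (planePoint (u, v)) (EuclideanSpace.single 0 1)) u := by
  have hn := halfPlane_mem_nhds (x := planePoint (u, v)) hu
  have h1 := ((hf.differentiableOn one_ne_zero) _ (mem_of_mem_nhds hn)).hasFDerivWithinAt.hasFDerivAt
    hn
  have h2 : HasDerivAt (fun s : ℝ => planePoint (s, v)) (EuclideanSpace.single 0 1) u := by
    simp only [planePoint_eq]
    simpa using ((hasDerivAt_id u).smul_const
      (EuclideanSpace.single (0 : Fin 2) (1 : ℝ))).add_const
        (v • EuclideanSpace.single (1 : Fin 2) (1 : ℝ))
  exact h1.comp_hasDerivAt u h2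

omit hK hKH h0 in
theorem hasDerivAt_line_snd {u v : ℝ} (hu : 0 < u) :
    HasDerivAt (fun s => f (planePoint (u, s))) (fderivWithin ℝ f (range (𝓡∂ 2))
      (planePoint (u, v)) (EuclideanSpace.single 1 1)) v := by
  have hn := halfPlane_mem_nhds (x := planePoint (u, v)) hu
  have h1 := ((hf.differentiableOn one_ne_zero) _ (mem_of_mem_nhds hn)).hasFDerivWithinAt.hasFDerivAt
    hn
  have h2 : HasDerivAt (fun s : ℝ => planePoint (u, s)) (EuclideanSpace.single 1 1) v := by
    simp only [planePoint_eq]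
    simpa using ((hasDerivAt_id v).smul_const
      (EuclideanSpace.single (1 : Fin 2) (1 : ℝ))).const_add
        (u • EuclideanSpace.single (0 : Fin 2) (1 : ℝ))
  exact h1.comp_hasDerivAt v h2

/-- Fubini and the fundamental theorem of calculus along the lines `v = const`: only the endpoint on
the edge contributes, as a lower limit, hence the sign. -/
theorem integral_halfPlane_fderivWithin_fst :
    ∫ x in range (𝓡∂ 2), fderivWithin ℝ f (range (𝓡∂ 2)) x (EuclideanSpace.single 0 1) =
      -∫ v : ℝ, f (planePoint (0, v)) := by
  have hi := integrable_halfPlane (integrableOn_fderivWithin_apply hf hK hKH h0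
    (EuclideanSpace.single 0 1))
  rw [setIntegral_halfPlane, integral_prod_symm _ hi, ← integral_neg]
  refine integral_congr_ae ?_
  filter_upwards [hi.prod_left_ae] with v hv
  obtain ⟨R, hR⟩ := exists_bound_of_isCompact hK
  rw [integral_Ioi_of_hasDerivAt_of_tendsto (f := fun u => f (planePoint (u, v))) (m := 0) ?_
    (fun u hu => hasDerivAt_line_fst hf hu) hv, zero_sub]
  -- For `u > R` the line has left `K`, so the limit at infinity is `0`.
  · refine tendsto_const_nhds.congr' ?_
    filter_upwards [Filter.eventually_gt_atTop R, Filter.eventually_gt_atTop 0] with u hu hu0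
    refine (h0 _ (mem_halfPlane.2 hu0.le) fun hmem => ?_).symm
    exact absurd ((le_abs_self _).trans (hR _ hmem).1) (not_le.2 hu)
  · refine (hf.continuousOn _ (mem_halfPlane.2 le_rfl)).comp (t := range (𝓡∂ 2))
      (f := fun u => planePoint (u, v)) ?_ fun u hu => mem_halfPlane.2 hu
    simp only [planePoint_eq]
    fun_prop

theorem integral_halfPlane_fderivWithin_snd :
    ∫ x in range (𝓡∂ 2), fderivWithin ℝ f (range (𝓡∂ 2)) x (EuclideanSpace.single 1 1) = 0 := by
  have hi := integrable_halfPlane (integrableOn_fderivWithin_apply hf hK hKH h0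
    (EuclideanSpace.single 1 1))
  have hfi := integrable_halfPlane (integrableOn_of_continuousOn_of_compl (μ := volume) hK
    isClosed_halfPlane.measurableSet
    (hf.continuousOn.mono hKH) h0)
  rw [setIntegral_halfPlane, integral_prod _ hi]
  refine integral_eq_zero_of_ae ?_
  filter_upwards [hi.prod_right_ae, hfi.prod_right_ae, ae_restrict_mem measurableSet_Ioi]
    with u hu hu' hu0
  exact integral_eq_zero_of_hasDerivAt_of_integrable
    (fun v => hasDerivAt_line_snd hf hu0) hu hu'

end Stokes

/-! ### Relatively open subsets of the half-plane -/

/-- `T` is a relatively open subset of the closed half-plane. -/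
def IsHalfPlaneOpen (T : Set Plane) : Prop :=
  T ⊆ range (𝓡∂ 2) ∧ ∀ x ∈ T, T ∈ nhdsWithin x (range (𝓡∂ 2))

namespace IsHalfPlaneOpen

variable {T : Set Plane} {V : Type*} [NormedAddCommGroup V] [NormedSpace ℝ V] {φ ψ : Plane → V}

theorem differentiableWithinAt (hT : IsHalfPlaneOpen T) {n : ℕ∞ω} (hφ : ContDiffOn ℝ n φ T)
    (hn : n ≠ 0) {x : Plane} (hx : x ∈ T) : DifferentiableWithinAt ℝ φ (range (𝓡∂ 2)) x :=
  (hφ.differentiableOn hn x hx).mono_of_mem_nhdsWithin (hT.2 x hx)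

theorem contDiffWithinAt (hT : IsHalfPlaneOpen T) {n : ℕ∞ω} (hφ : ContDiffOn ℝ n φ T)
    {x : Plane} (hx : x ∈ T) : ContDiffWithinAt ℝ n φ (range (𝓡∂ 2)) x :=
  (hφ x hx).mono_of_mem_nhdsWithin (hT.2 x hx)

theorem contDiffOn_fderivWithin (hT : IsHalfPlaneOpen T) (hφ : ContDiffOn ℝ ∞ φ T) :
    ContDiffOn ℝ ∞ (fderivWithin ℝ φ (range (𝓡∂ 2))) T := fun x hx =>
  ((hT.contDiffWithinAt hφ hx).fderivWithin_right uniqueDiffOn_halfPlane (by simp)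
    (hT.1 hx)).mono hT.1

theorem fderivWithin_congr (hT : IsHalfPlaneOpen T) (h : EqOn φ ψ T) {x : Plane} (hx : x ∈ T) :
    fderivWithin ℝ φ (range (𝓡∂ 2)) x = fderivWithin ℝ ψ (range (𝓡∂ 2)) x :=
  Filter.EventuallyEq.fderivWithin_eq (Filter.mem_of_superset (hT.2 x hx) h) (h hx)

theorem exists_isOpen_inter_eq (hT : IsHalfPlaneOpen T) : ∃ U : Set Plane, IsOpen U ∧ T = U ∩ range (𝓡∂ 2) := by
  choose! U hUo hxU hU using fun x hx => mem_nhdsWithin.1 (hT.2 x hx)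
  refine ⟨⋃ x ∈ T, U x, isOpen_biUnion hUo, Subset.antisymm ?_ ?_⟩
  · exact fun x hx => ⟨mem_biUnion hx (hxU x hx), hT.1 hx⟩
  · rintro y ⟨hy, hyH⟩
    obtain ⟨x, hx, hyx⟩ := mem_iUnion₂.1 hy
    exact hU x hx ⟨hyx, hyH⟩

theorem measurableSet (hT : IsHalfPlaneOpen T) : MeasurableSet T := by
  obtain ⟨U, hU, rfl⟩ := hT.exists_isOpen_inter_eq
  exact hU.measurableSet.inter isClosed_halfPlane.measurableSet

end IsHalfPlaneOpen

theorem contDiffOn_partialDeriv {T : Set Plane} (hT : IsHalfPlaneOpen T) {φ : Plane → Space}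
    (hφ : ContDiffOn ℝ ∞ φ T) (k : Fin 2) : ContDiffOn ℝ ∞ (partialDeriv k φ) T :=
  (hT.contDiffOn_fderivWithin hφ).clm_apply contDiffOn_const

/-- Symmetry persists on the edge because every point of the half-plane lies in the closure of its
interior. -/
theorem partialDeriv_comm {T : Set Plane} (hT : IsHalfPlaneOpen T) {φ : Plane → Space}
    (hφ : ContDiffOn ℝ ∞ φ T) {x : Plane} (hx : x ∈ T) (j k : Fin 2) :
    partialDeriv j (partialDeriv k φ) x = partialDeriv k (partialDeriv j φ) x := by
  have hs : IsSymmSndFDerivWithinAt ℝ φ (range (𝓡∂ 2)) x :=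
    (hT.contDiffWithinAt hφ hx).isSymmSndFDerivWithinAt
      (by rw [minSmoothness_of_isRCLikeNormedField]; exact WithTop.coe_le_coe.2 le_top) uniqueDiffOn_halfPlane
      ((𝓡∂ 2).range_subset_closure_interior (hT.1 hx)) (hT.1 hx)
  have hd := hT.differentiableWithinAt (hT.contDiffOn_fderivWithin hφ) (by simp) hx
  have hu := uniqueDiffOn_halfPlane x (hT.1 hx)
  have key : ∀ j k : Fin 2, partialDeriv j (partialDeriv k φ) x =
      fderivWithin ℝ (fderivWithin ℝ φ (range (𝓡∂ 2))) (range (𝓡∂ 2)) x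
        (EuclideanSpace.single j 1) (EuclideanSpace.single k 1) := by
    intro j k
    have := fderivWithin_clm_apply hu hd
      (differentiableWithinAt_const (EuclideanSpace.single k (1 : ℝ)))
    change fderivWithin ℝ (fun y => fderivWithin ℝ φ (range (𝓡∂ 2)) y
      (EuclideanSpace.single k 1)) _ x _ = _
    rw [this]
    simp
  rw [key, key]
  exact hs _ _

/-! ### Stokes' formula on a relatively open set -/

section LocalStokes

variable {T K : Set Plane} (hT : IsHalfPlaneOpen T) (hK : IsCompact K) (hKT : K ⊆ T) {h : Plane → ℝ}
  (hh : ContDiffOn ℝ 1 h T) (h0 : ∀ x ∈ T, x ∉ K → h x = 0)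

include hT hK hKT hh h0

/-- Extension by zero keeps the regularity: `T` is a relative neighbourhood of each point of `K`,
and off the closed set `K` the extension is locally zero. This reduces chart domains to the whole
half-plane. -/
theorem contDiffOn_indicator : ContDiffOn ℝ 1 (T.indicator h) (range (𝓡∂ 2)) := by
  intro x hx
  by_cases hxK : x ∈ K
  · have hxT := hKT hxK
    refine (hT.contDiffWithinAt hh hxT).congr_of_eventuallyEq ?_ (indicator_of_mem hxT h)
    filter_upwards [hT.2 x hxT] with y hy using indicator_of_mem hy h
  · have hz : ∀ y, y ∉ K → T.indicator h y = 0 := fun y hy => by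
      by_cases hyT : y ∈ T
      · rw [indicator_of_mem hyT, h0 y hyT hy]
      · exact indicator_of_notMem hyT h
    refine (contDiffWithinAt_const (c := (0 : ℝ))).congr_of_eventuallyEq ?_ (hz x hxK)
    exact Filter.mem_of_superset
      (mem_nhdsWithin_of_mem_nhds (hK.isClosed.isOpen_compl.mem_nhds hxK)) hz

omit hh hT hK hKT in
theorem indicator_eq_zero_of_notMem {y : Plane} (hy : y ∉ K) : T.indicator h y = 0 := by
  by_cases hyT : y ∈ T
  · rw [indicator_of_mem hyT, h0 y hyT hy]
  · exact indicator_of_notMem hyT h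

omit hh in
theorem setIntegral_fderivWithin_indicator (w : Plane) :
    ∫ x in T, fderivWithin ℝ h (range (𝓡∂ 2)) x w =
      ∫ x in range (𝓡∂ 2), fderivWithin ℝ (T.indicator h) (range (𝓡∂ 2)) x w := by
  rw [setIntegral_eq_of_subset_of_forall_sdiff_eq_zero (s := T)
    isClosed_halfPlane.measurableSet hT.1]
  · refine setIntegral_congr_fun hT.measurableSet fun x hx => ?_
    rw [hT.fderivWithin_congr (fun y hy => (indicator_of_mem hy h).symm) hx]
  · intro x hx
    rw [fderivWithin_eq_zero_of_compl hK (fun y _ hy => indicator_eq_zero_of_notMem h0 hy) hx.1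
      fun hxK => hx.2 (hKT hxK)]
    rfl

theorem setIntegral_fderivWithin_fst :
    ∫ x in T, fderivWithin ℝ h (range (𝓡∂ 2)) x (EuclideanSpace.single 0 1) =
      -∫ v in {v : ℝ | !₂[0, v] ∈ T}, h !₂[0, v] := by
  rw [setIntegral_fderivWithin_indicator hT hK hKT h0, integral_halfPlane_fderivWithin_fst
    (contDiffOn_indicator hT hK hKT hh h0) hK (hKT.trans hT.1)
    fun x _ hx => indicator_eq_zero_of_notMem h0 hx]
  congr 1
  have hm : MeasurableSet {v : ℝ | (!₂[0, v] : Plane) ∈ T} :=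
    hT.measurableSet.preimage (f := fun v : ℝ => (!₂[0, v] : Plane)) (by fun_prop)
  rw [← integral_indicator hm]
  rfl

theorem setIntegral_fderivWithin_snd :
    ∫ x in T, fderivWithin ℝ h (range (𝓡∂ 2)) x (EuclideanSpace.single 1 1) = 0 := by
  rw [setIntegral_fderivWithin_indicator hT hK hKT h0, integral_halfPlane_fderivWithin_snd
    (contDiffOn_indicator hT hK hKT hh h0) hK (hKT.trans hT.1)
    fun x _ hx => indicator_eq_zero_of_notMem h0 hx]

theorem integrableOn_target_fderivWithin_apply (w : Plane) :
    IntegrableOn (fun x => fderivWithin ℝ h (range (𝓡∂ 2)) x w) T := by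
  refine ((integrableOn_fderivWithin_apply (contDiffOn_indicator hT hK hKT hh h0) hK
    (hKT.trans hT.1) (fun x _ hx => indicator_eq_zero_of_notMem h0 hx) w).mono_set
      hT.1).congr_fun (fun x hx => ?_) hT.measurableSet
  change fderivWithin ℝ _ _ x w = _
  rw [hT.fderivWithin_congr (fun y hy => indicator_of_mem hy h) hx]

end LocalStokes

/-! ### The charts of the surface -/

section Charts

variable {M : Type*} [TopologicalSpace M] [ChartedSpace (EuclideanHalfSpace 2) M]

theorem isHalfPlaneOpen_target (i : M) : IsHalfPlaneOpen (extChartAt (𝓡∂ 2) i).target :=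
  ⟨extChartAt_target_subset_range i, fun _ hx => extChartAt_target_mem_nhdsWithin_of_mem hx⟩

variable [IsManifold (𝓡∂ 2) ∞ M]

theorem contDiffOn_inChart {V : Type*} [NormedAddCommGroup V] [NormedSpace ℝ V] {f : M → V}
    (hf : ContMDiff (𝓡∂ 2) 𝓘(ℝ, V) ∞ f) (i : M) :
    ContDiffOn ℝ ∞ (inChart f i) (extChartAt (𝓡∂ 2) i).target :=
  contMDiffOn_iff_contDiffOn.1 (hf.comp_contMDiffOn (contMDiffOn_extChartAt_symm i))

/-- The differential of the inverse of the chart at `i`. -/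
def chartDiff (i : M) (x : Plane) :
    Plane →L[ℝ] TangentSpace (𝓡∂ 2) ((extChartAt (𝓡∂ 2) i).symm x) :=
  mfderivWithin 𝓘(ℝ, Plane) (𝓡∂ 2) (extChartAt (𝓡∂ 2) i).symm (range (𝓡∂ 2)) x

theorem fderivWithin_inChart {f : M → Space} (hf : ContMDiff (𝓡∂ 2) 𝓘(ℝ, Space) ∞ f) (i : M)
    {x : Plane} (hx : x ∈ (extChartAt (𝓡∂ 2) i).target) (w : Plane) :
    fderivWithin ℝ (inChart f i) (range (𝓡∂ 2)) x w =
      diff f ((extChartAt (𝓡∂ 2) i).symm x) (chartDiff i x w) := by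
  have : IsManifold (𝓡∂ 2) 1 M := IsManifold.of_le (n := ∞) (by simp)
  have h := mfderiv_comp_mfderivWithin x (s := range (𝓡∂ 2)) (I := 𝓘(ℝ, Plane))
    ((hf.mdifferentiable (by simp)) _)
    (mdifferentiableWithinAt_extChartAt_symm hx)
    (uniqueMDiffWithinAt_iff_uniqueDiffWithinAt.2
      (uniqueDiffOn_halfPlane x (extChartAt_target_subset_range i hx)))
  rw [mfderivWithin_eq_fderivWithin] at h
  exact congrArg (fun L : Plane →L[ℝ] Space => L w) h

theorem normalVec_inChart_ne_zero {r : M → Space} (hr : IsSmoothImmersion r) (i : M)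
    {x : Plane} (hx : x ∈ (extChartAt (𝓡∂ 2) i).target) : normalVec (inChart r i) x ≠ 0 := by
  have : IsManifold (𝓡∂ 2) 1 M := IsManifold.of_le (n := ∞) (by simp)
  rw [normalVec, crossProduct_ne_zero_iff_linearIndependent]
  have hinj : Function.Injective (fderivWithin ℝ (inChart r i) (range (𝓡∂ 2)) x) := by
    have h1 : Function.Injective (chartDiff i x) :=
      (isInvertible_mfderivWithin_extChartAt_symm hx).injective
    have h2 := (hr.2 ((extChartAt (𝓡∂ 2) i).symm x)).comp h1
    intro v w hvw
    rw [fderivWithin_inChart hr.1 i hx, fderivWithin_inChart hr.1 i hx] at hvw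
    exact h2 hvw
  have hli := (EuclideanSpace.basisFun (Fin 2) ℝ).toBasis.linearIndependent.map'
    (fderivWithin ℝ (inChart r i) (range (𝓡∂ 2)) x : Plane →ₗ[ℝ] Space)
    (LinearMap.ker_eq_bot.2 hinj)
  have he : ![partialDeriv 0 (inChart r i) x, partialDeriv 1 (inChart r i) x] =
      (fderivWithin ℝ (inChart r i) (range (𝓡∂ 2)) x : Plane →ₗ[ℝ] Space) ∘
        (EuclideanSpace.basisFun (Fin 2) ℝ).toBasis := by
    funext k
    fin_cases k <;> simp [partialDeriv]
  rw [← he] at hli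
  exact hli

theorem partialDeriv_inChart_rotation {r z y : M → Space}
    (hr : ContMDiff (𝓡∂ 2) 𝓘(ℝ, Space) ∞ r) (hz : ContMDiff (𝓡∂ 2) 𝓘(ℝ, Space) ∞ z)
    (hy : IsRotationField r z y) (i : M) {x : Plane}
    (hx : x ∈ (extChartAt (𝓡∂ 2) i).target) (k : Fin 2) :
    partialDeriv k (inChart z i) x = inChart y i x ⨯₃ partialDeriv k (inChart r i) x := by
  rw [partialDeriv, partialDeriv, fderivWithin_inChart hz i hx, fderivWithin_inChart hr i hx]
  exact hy _ _

end Charts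

/-! ### Smoothness of the rotation field -/

theorem contDiffOn_dotProduct {E : Type*} [NormedAddCommGroup E] [NormedSpace ℝ E] {T : Set E}
    {n : ℕ∞ω} {f g : E → Space} (hf : ContDiffOn ℝ n f T) (hg : ContDiffOn ℝ n g T) : ContDiffOn ℝ n (fun x => f x ⬝ᵥ g x) T := by
  have hf' := contDiffOn_pi.1 hf
  have hg' := contDiffOn_pi.1 hg
  exact ContDiffOn.sum fun i _ => (hf' i).mul (hg' i)

theorem contDiffOn_crossProduct {E : Type*} [NormedAddCommGroup E] [NormedSpace ℝ E] {T : Set E}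
    {n : ℕ∞ω} {f g : E → Space} (hf : ContDiffOn ℝ n f T) (hg : ContDiffOn ℝ n g T) :
    ContDiffOn ℝ n (fun x => f x ⨯₃ g x) T := by
  have hf' := contDiffOn_pi.1 hf
  have hg' := contDiffOn_pi.1 hg
  refine contDiffOn_pi.2 fun i => ?_
  fin_cases i <;> simp [cross_apply]
  · exact ((hf' 1).mul (hg' 2)).sub ((hf' 2).mul (hg' 1))
  · exact ((hf' 2).mul (hg' 0)).sub ((hf' 0).mul (hg' 2))
  · exact ((hf' 0).mul (hg' 1)).sub ((hf' 1).mul (hg' 0))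

/-- By `normal_sq_smul_rotation`, `y` is a smooth expression in the first derivatives of `r` and
`z`, divided by `|r_u × r_v|²`, which does not vanish for an immersion. -/
theorem contDiffOn_inChart_rotation {M : Type*} [TopologicalSpace M]
    [ChartedSpace (EuclideanHalfSpace 2) M] [IsManifold (𝓡∂ 2) ∞ M] {r z y : M → Space}
    (hr : IsSmoothImmersion r) (hz : ContMDiff (𝓡∂ 2) 𝓘(ℝ, Space) ∞ z)
    (hy : IsRotationField r z y) (i : M) :
    ContDiffOn ℝ ∞ (inChart y i) (extChartAt (𝓡∂ 2) i).target := by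
  have hT := isHalfPlaneOpen_target i
  have ha := contDiffOn_partialDeriv hT (contDiffOn_inChart hr.1 i) 0
  have hb := contDiffOn_partialDeriv hT (contDiffOn_inChart hr.1 i) 1
  have hc := contDiffOn_partialDeriv hT (contDiffOn_inChart hz i) 0
  have hd := contDiffOn_partialDeriv hT (contDiffOn_inChart hz i) 1
  have hN := contDiffOn_crossProduct ha hb
  have hNN := contDiffOn_dotProduct hN hN
  have hpos : ∀ x ∈ (extChartAt (𝓡∂ 2) i).target,
      normalVec (inChart r i) x ⬝ᵥ normalVec (inChart r i) x ≠ 0 := fun x hx =>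
    (dotProduct_self_pos (normalVec_inChart_ne_zero hr i hx)).ne'
  refine ((hNN.inv hpos).smul (((contDiffOn_dotProduct hc hb).smul hN).add
    (contDiffOn_crossProduct hN ((contDiffOn_crossProduct hc hb).add
      (contDiffOn_crossProduct ha hd))))).congr fun x hx => ?_
  have key := normal_sq_smul_rotation (partialDeriv 0 (inChart r i) x)
    (partialDeriv 1 (inChart r i) x) (inChart y i x)
  rw [← partialDeriv_inChart_rotation hr.1 hz hy i hx,
    ← partialDeriv_inChart_rotation hr.1 hz hy i hx] at key
  exact (eq_inv_smul_iff₀ (hpos x hx)).2 key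

/-! ### Changes of coordinates -/

/-- The density of the two-form `α ∧ (y · B)` in the parameter plane. -/
def wedge (α : Plane →L[ℝ] ℝ) (y : Space) (B : Plane →L[ℝ] Space) : ℝ :=
  α (EuclideanSpace.single 0 1) * (y ⬝ᵥ B (EuclideanSpace.single 1 1)) -
    α (EuclideanSpace.single 1 1) * (y ⬝ᵥ B (EuclideanSpace.single 0 1))

theorem det_plane (L : Plane →L[ℝ] Plane) : L.det =
    L (EuclideanSpace.single 0 1) 0 * L (EuclideanSpace.single 1 1) 1 -
      L (EuclideanSpace.single 1 1) 0 * L (EuclideanSpace.single 0 1) 1 := by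
  change LinearMap.det (L : Plane →ₗ[ℝ] Plane) = _
  rw [← LinearMap.det_toMatrix (EuclideanSpace.basisFun (Fin 2) ℝ).toBasis, Matrix.det_fin_two]
  simp [LinearMap.toMatrix_apply]

theorem plane_eq (x : Plane) :
    x = x 0 • EuclideanSpace.single (0 : Fin 2) (1 : ℝ) + x 1 • EuclideanSpace.single 1 1 := by
  ext i; fin_cases i <;> simp

theorem wedge_comp (α : Plane →L[ℝ] ℝ) (y : Space) (B : Plane →L[ℝ] Space)
    (L : Plane →L[ℝ] Plane) : wedge (α.comp L) y (B.comp L) = L.det * wedge α y B := by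
  simp only [wedge, ContinuousLinearMap.comp_apply]
  rw [det_plane, plane_eq (L (EuclideanSpace.single 0 1)), plane_eq (L (EuclideanSpace.single 1 1))]
  simp only [map_add, map_smul, dotProduct_add, dotProduct_smul, smul_eq_mul]
  simp
  ring

section Charts

variable {M : Type*} [TopologicalSpace M] [ChartedSpace (EuclideanHalfSpace 2) M]

/-- The domain of the change of coordinates from the chart at `i` to the chart at `j`. -/
def overlap (i j : M) : Set Plane :=
  ((extChartAt (𝓡∂ 2) i).symm.trans (extChartAt (𝓡∂ 2) j)).source

/-- The change of coordinates from the chart at `i` to the chart at `j`. -/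
def transition (i j : M) : Plane → Plane :=
  extChartAt (𝓡∂ 2) j ∘ (extChartAt (𝓡∂ 2) i).symm

theorem mem_overlap {i j : M} {x : Plane} : x ∈ overlap i j ↔
    x ∈ (extChartAt (𝓡∂ 2) i).target ∧
      (extChartAt (𝓡∂ 2) i).symm x ∈ (extChartAt (𝓡∂ 2) j).source := by
  rw [overlap, PartialEquiv.trans_source, PartialEquiv.symm_source]; rfl

theorem isHalfPlaneOpen_overlap (i j : M) : IsHalfPlaneOpen (overlap i j) := by
  refine ⟨fun x hx => (isHalfPlaneOpen_target i).1 (mem_overlap.1 hx).1, fun x hx => ?_⟩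
  have hx' := mem_overlap.1 hx
  filter_upwards [(isHalfPlaneOpen_target i).2 x hx'.1, mem_nhdsWithin_of_mem_nhds
    ((continuousAt_extChartAt_symm'' hx'.1).preimage_mem_nhds
      ((isOpen_extChartAt_source (I := 𝓡∂ 2) j).mem_nhds hx'.2))] with y hy hy'
  exact mem_overlap.2 ⟨hy, hy'⟩

theorem image_transition_overlap (i j : M) : transition i j '' overlap i j = overlap j i := by
  have := ((extChartAt (𝓡∂ 2) i).symm.trans (extChartAt (𝓡∂ 2) j)).image_source_eq_target
  rwa [← PartialEquiv.symm_source, PartialEquiv.trans_symm_eq_symm_trans_symm,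
    PartialEquiv.symm_symm] at this

theorem injOn_transition (i j : M) : InjOn (transition i j) (overlap i j) :=
  ((extChartAt (𝓡∂ 2) i).symm.trans (extChartAt (𝓡∂ 2) j)).injOn

theorem extChartAt_symm_transition {i j : M} {x : Plane} (hx : x ∈ overlap i j) :
    (extChartAt (𝓡∂ 2) j).symm (transition i j x) = (extChartAt (𝓡∂ 2) i).symm x :=
  (extChartAt (𝓡∂ 2) j).left_inv (mem_overlap.1 hx).2

theorem inChart_transition {X : Type*} (f : M → X) {i j : M} {x : Plane} (hx : x ∈ overlap i j) :
    inChart f j (transition i j x) = inChart f i x :=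
  congrArg f (extChartAt_symm_transition hx)

theorem det_fderivWithin_transition_pos (hM : IsOrientedAtlas M) {i j : M} {x : Plane}
    (hx : x ∈ overlap i j) :
    0 < (fderivWithin ℝ (transition i j) (range (𝓡∂ 2)) x).det := by
  have hx' := mem_overlap.1 hx
  have h := hM _ (chart_mem_atlas _ i) _ (chart_mem_atlas _ j) ((extChartAt (𝓡∂ 2) i).symm x)
    ⟨by simpa using (extChartAt (𝓡∂ 2) i).map_target hx'.1, by simpa using hx'.2⟩
  have hr : ((chartAt (EuclideanHalfSpace 2) i).extend (𝓡∂ 2)) ((extChartAt (𝓡∂ 2) i).symm x) = x :=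
    (extChartAt (𝓡∂ 2) i).right_inv hx'.1
  rw [hr] at h
  exact h

variable [IsManifold (𝓡∂ 2) ∞ M]

theorem differentiableWithinAt_transition {i j : M} {x : Plane} (hx : x ∈ overlap i j) :
    DifferentiableWithinAt ℝ (transition i j) (range (𝓡∂ 2)) x :=
  (contDiffWithinAt_ext_coord_change (n := ∞) j i hx).differentiableWithinAt (by simp)

theorem fderivWithin_inChart_transition {V : Type*} [NormedAddCommGroup V] [NormedSpace ℝ V]
    {f : M → V} (hf : ContMDiff (𝓡∂ 2) 𝓘(ℝ, V) ∞ f) {i j : M} {x : Plane}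
    (hx : x ∈ overlap i j) :
    fderivWithin ℝ (inChart f i) (range (𝓡∂ 2)) x =
      (fderivWithin ℝ (inChart f j) (range (𝓡∂ 2)) (transition i j x)).comp
        (fderivWithin ℝ (transition i j) (range (𝓡∂ 2)) x) := by
  have hτ : transition i j x ∈ (extChartAt (𝓡∂ 2) j).target :=
    (extChartAt (𝓡∂ 2) j).map_source (mem_overlap.1 hx).2
  have hf' := (isHalfPlaneOpen_target j).differentiableWithinAt (contDiffOn_inChart hf j)
    (by simp) hτ
  have hO := isHalfPlaneOpen_overlap i j
  rw [← fderivWithin_comp x hf' (differentiableWithinAt_transition hx)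
    (fun y _ => ?_) (uniqueDiffOn_halfPlane x (hO.1 hx))]
  · exact hO.fderivWithin_congr (fun y hy => (inChart_transition f hy).symm) hx
  · exact ⟨_, rfl⟩

/-- The density of the two-form `dg ∧ (y · dr)` in the chart at `i`. -/
def wedgeDensity (g : M → ℝ) (r y : M → Space) (i : M) (x : Plane) : ℝ :=
  wedge (fderivWithin ℝ (inChart g i) (range (𝓡∂ 2)) x) (inChart y i x)
    (fderivWithin ℝ (inChart r i) (range (𝓡∂ 2)) x)

/-- Change of variables produces `|det|`, while the two-form pulls back with `det`; the oriented
atlas makes them equal. -/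
theorem setIntegral_overlap_wedgeDensity (hM : IsOrientedAtlas M) {g : M → ℝ} {r y : M → Space}
    (hg : ContMDiff (𝓡∂ 2) 𝓘(ℝ, ℝ) ∞ g) (hr : ContMDiff (𝓡∂ 2) 𝓘(ℝ, Space) ∞ r)
    (h : M → ℝ) (i j : M) :
    ∫ x in overlap i j, inChart h i x * wedgeDensity g r y i x =
      ∫ x in overlap j i, inChart h j x * wedgeDensity g r y j x := by
  rw [← image_transition_overlap i j, integral_image_eq_integral_abs_det_fderiv_smul volume
    (isHalfPlaneOpen_overlap i j).measurableSet
    (fun x hx => (differentiableWithinAt_transition hx).hasFDerivWithinAt.mono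
      (isHalfPlaneOpen_overlap i j).1) (injOn_transition i j)]
  refine setIntegral_congr_fun (isHalfPlaneOpen_overlap i j).measurableSet fun x hx => ?_
  simp only [wedgeDensity]
  rw [abs_of_pos (det_fderivWithin_transition_pos hM hx), inChart_transition h hx,
    inChart_transition y hx, fderivWithin_inChart_transition hg hx,
    fderivWithin_inChart_transition hr hx, wedge_comp, smul_eq_mul]
  ring

/-- Both integrands vanish off the overlap: in the chart at `i` because `h` does, and in the chart
at `j` because `g` is locally zero there, hence so is `dg`. -/
theorem setIntegral_target_wedgeDensity (hM : IsOrientedAtlas M) {g : M → ℝ} {r y : M → Space}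
    (hg : ContMDiff (𝓡∂ 2) 𝓘(ℝ, ℝ) ∞ g) (hr : ContMDiff (𝓡∂ 2) 𝓘(ℝ, Space) ∞ r)
    (h : M → ℝ) (i j : M) (hgi : tsupport g ⊆ (extChartAt (𝓡∂ 2) i).source)
    (hhj : tsupport h ⊆ (extChartAt (𝓡∂ 2) j).source) :
    ∫ x in (extChartAt (𝓡∂ 2) i).target, inChart h i x * wedgeDensity g r y i x =
      ∫ x in (extChartAt (𝓡∂ 2) j).target, inChart h j x * wedgeDensity g r y j x := by
  rw [setIntegral_eq_of_subset_of_forall_sdiff_eq_zero (s := overlap i j)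
      (isHalfPlaneOpen_target i).measurableSet (fun x hx => (mem_overlap.1 hx).1),
    setIntegral_eq_of_subset_of_forall_sdiff_eq_zero (s := overlap j i)
      (isHalfPlaneOpen_target j).measurableSet (fun x hx => (mem_overlap.1 hx).1),
    setIntegral_overlap_wedgeDensity hM hg hr]
  · rintro x ⟨hx, hxO⟩
    have hx0 : (extChartAt (𝓡∂ 2) j).symm x ∉ tsupport g := fun hmem =>
      hxO (mem_overlap.2 ⟨hx, hgi hmem⟩)
    have hev : inChart g j =ᶠ[nhdsWithin x (range (𝓡∂ 2))] fun _ => 0 := by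
      filter_upwards [mem_nhdsWithin_of_mem_nhds ((continuousAt_extChartAt_symm'' hx).preimage_mem_nhds
        ((isClosed_tsupport g).isOpen_compl.mem_nhds hx0))] with y hy
      exact image_eq_zero_of_notMem_tsupport (f := g) hy
    rw [wedgeDensity, hev.fderivWithin_eq (image_eq_zero_of_notMem_tsupport (f := g) hx0)]
    simp [wedge]
  · rintro x ⟨hx, hxO⟩
    have hx0 : inChart h i x = 0 := image_eq_zero_of_notMem_tsupport (f := h) fun hmem =>
      hxO (mem_overlap.2 ⟨hx, hhj hmem⟩)
    rw [hx0, zero_mul]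

theorem continuousOn_wedgeDensity {g : M → ℝ} {r y : M → Space}
    (hg : ContMDiff (𝓡∂ 2) 𝓘(ℝ, ℝ) ∞ g) (hr : ContMDiff (𝓡∂ 2) 𝓘(ℝ, Space) ∞ r) {i : M}
    (hy : ContDiffOn ℝ ∞ (inChart y i) (extChartAt (𝓡∂ 2) i).target) :
    ContinuousOn (wedgeDensity g r y i) (extChartAt (𝓡∂ 2) i).target := by
  have hT := isHalfPlaneOpen_target i
  have hg' := fun w : Plane => (hT.contDiffOn_fderivWithin (contDiffOn_inChart hg i)).clm_apply
    (contDiffOn_const (c := w))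
  have hr' := fun w : Plane => (hT.contDiffOn_fderivWithin (contDiffOn_inChart hr i)).clm_apply
    (contDiffOn_const (c := w))
  exact (((hg' _).mul (contDiffOn_dotProduct hy (hr' _))).sub
    ((hg' _).mul (contDiffOn_dotProduct hy (hr' _)))).continuousOn

end Charts

/-! ### Cancellation over the partition of unity -/

section Partition

variable {M : Type*} [TopologicalSpace M] [ChartedSpace (EuclideanHalfSpace 2) M]
  [T2Space M] [CompactSpace M] [IsManifold (𝓡∂ 2) ∞ M]

theorem tsupport_chartPartition_subset (i : M) :
    tsupport (chartPartition M i) ⊆ (extChartAt (𝓡∂ 2) i).source := by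
  rw [extChartAt_source]
  exact (SmoothPartitionOfUnity.exists_isSubordinate_chartAt_source (𝓡∂ 2) M).choose_spec i

/-- The support of the `i`-th function of the partition of unity, in the chart at `i`. -/
def chartSupport (i : M) : Set Plane :=
  extChartAt (𝓡∂ 2) i '' tsupport (chartPartition M i)

theorem isCompact_chartSupport (i : M) : IsCompact (chartSupport i) :=
  (isClosed_tsupport _).isCompact.image_of_continuousOn
    ((continuousOn_extChartAt i).mono (tsupport_chartPartition_subset i))

theorem chartSupport_subset (i : M) : chartSupport i ⊆ (extChartAt (𝓡∂ 2) i).target := by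
  rintro _ ⟨p, hp, rfl⟩
  exact (extChartAt (𝓡∂ 2) i).map_source (tsupport_chartPartition_subset i hp)

theorem inChart_chartPartition_eq_zero {i : M} {x : Plane}
    (hx : x ∈ (extChartAt (𝓡∂ 2) i).target) (hxK : x ∉ chartSupport i) :
    inChart (chartPartition M i) i x = 0 :=
  image_eq_zero_of_notMem_tsupport (f := chartPartition M i) fun hmem =>
    hxK ⟨_, hmem, (extChartAt (𝓡∂ 2) i).right_inv hx⟩

theorem fderivWithin_inChart_chartPartition_eq_zero {i : M} {x : Plane}
    (hx : x ∈ (extChartAt (𝓡∂ 2) i).target) (hxK : x ∉ chartSupport i) :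
    fderivWithin ℝ (inChart (chartPartition M i) i) (range (𝓡∂ 2)) x = 0 := by
  have hev : inChart (chartPartition M i) i =ᶠ[nhdsWithin x (range (𝓡∂ 2))] fun _ => 0 := by
    filter_upwards [(isHalfPlaneOpen_target i).2 x hx, mem_nhdsWithin_of_mem_nhds
      ((isCompact_chartSupport i).isClosed.isOpen_compl.mem_nhds hxK)] with y hy hyK
    exact inChart_chartPartition_eq_zero hy hyK
  rw [hev.fderivWithin_eq (inChart_chartPartition_eq_zero hx hxK)]
  simp

theorem finite_chartPartition_ne_zero (M : Type*) [TopologicalSpace M]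
    [ChartedSpace (EuclideanHalfSpace 2) M] [T2Space M] [CompactSpace M]
    [IsManifold (𝓡∂ 2) ∞ M] :
    {i : M | (Function.support (chartPartition M i)).Nonempty}.Finite :=
  (chartPartition M).locallyFinite.finite_nonempty_of_compact

/-- The indices of the functions of the partition of unity that do not vanish. -/
def activeCharts (M : Type*) [TopologicalSpace M] [ChartedSpace (EuclideanHalfSpace 2) M]
    [T2Space M] [CompactSpace M] [IsManifold (𝓡∂ 2) ∞ M] : Finset M :=
  (finite_chartPartition_ne_zero M).toFinset

theorem chartPartition_eq_zero {i : M} (hi : i ∉ activeCharts M) (p : M) :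
    chartPartition M i p = 0 := by
  by_contra h
  exact hi ((finite_chartPartition_ne_zero M).mem_toFinset.2 ⟨p, h⟩)

theorem sum_chartPartition (p : M) : ∑ i ∈ activeCharts M, chartPartition M i p = 1 := by
  rw [← (chartPartition M).sum_eq_one (mem_univ p)]
  exact (finsum_eq_sum_of_support_subset _ fun i hi => by
    by_contra h
    exact hi (chartPartition_eq_zero h p)).symm

theorem sum_wedgeDensity_chartPartition (r y : M → Space) {j : M} {x : Plane}
    (hx : x ∈ (extChartAt (𝓡∂ 2) j).target) :
    ∑ i ∈ activeCharts M, wedgeDensity (chartPartition M i) r y j x = 0 := by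
  have hsum : ∑ i ∈ activeCharts M,
      fderivWithin ℝ (inChart (chartPartition M i) j) (range (𝓡∂ 2)) x = 0 := by
    rw [← fderivWithin_fun_sum (uniqueDiffOn_halfPlane x ((isHalfPlaneOpen_target j).1 hx))
      fun i _ => (isHalfPlaneOpen_target j).differentiableWithinAt
        (contDiffOn_inChart (chartPartition M i).contMDiff j) (by simp) hx]
    have : (fun x => ∑ i ∈ activeCharts M, inChart (chartPartition M i) j x) = fun _ => (1 : ℝ) :=
      funext fun x => sum_chartPartition _
    rw [this]
    simp
  have happ := fun w : Plane => congrArg (fun L : Plane →L[ℝ] ℝ => L w) hsum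
  simp only [_root_.sum_apply, _root_.zero_apply] at happ
  simp only [wedgeDensity, wedge, Finset.sum_sub_distrib, ← Finset.sum_mul, happ, zero_mul, sub_zero]

/-- The summands live in different charts and cannot be added pointwise. Inserting `∑ ρ_j = 1` and
moving the `(i, j)` term to the chart at `j` allows the sum over `i` to be taken there, where `∑
dρ_i = 0`. -/
theorem sum_setIntegral_wedgeDensity (hM : IsOrientedAtlas M) {r y : M → Space}
    (hr : ContMDiff (𝓡∂ 2) 𝓘(ℝ, Space) ∞ r)
    (hy : ∀ i, ContDiffOn ℝ ∞ (inChart y i) (extChartAt (𝓡∂ 2) i).target) :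
    ∑ i ∈ activeCharts M, ∫ x in (extChartAt (𝓡∂ 2) i).target,
      wedgeDensity (chartPartition M i) r y i x = 0 := by
  have hcont : ∀ i j k : M, ContinuousOn (fun x => inChart (chartPartition M j) k x *
      wedgeDensity (chartPartition M i) r y k x) (extChartAt (𝓡∂ 2) k).target := fun i j k =>
    (contDiffOn_inChart (chartPartition M j).contMDiff k).continuousOn.mul
      (continuousOn_wedgeDensity (chartPartition M i).contMDiff hr (hy k))
  -- In the chart at `i` compact support comes from `dρ_i`; in the chart at `j` (next claim) it
  -- comes from `ρ_j`.
  have hint1 : ∀ i j : M, IntegrableOn (fun x => inChart (chartPartition M j) i x *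
      wedgeDensity (chartPartition M i) r y i x) (extChartAt (𝓡∂ 2) i).target := fun i j =>
    integrableOn_of_continuousOn_of_compl (isCompact_chartSupport i)
      (isHalfPlaneOpen_target i).measurableSet ((hcont i j i).mono (chartSupport_subset i))
      fun x hx hxK => by
        rw [wedgeDensity, fderivWithin_inChart_chartPartition_eq_zero hx hxK]
        simp [wedge]
  have hint2 : ∀ i j : M, IntegrableOn (fun x => inChart (chartPartition M j) j x *
      wedgeDensity (chartPartition M i) r y j x) (extChartAt (𝓡∂ 2) j).target := fun i j =>
    integrableOn_of_continuousOn_of_compl (isCompact_chartSupport j)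
      (isHalfPlaneOpen_target j).measurableSet ((hcont i j j).mono (chartSupport_subset j))
      fun x hx hxK => by
        rw [inChart_chartPartition_eq_zero hx hxK, zero_mul]
  calc ∑ i ∈ activeCharts M, ∫ x in (extChartAt (𝓡∂ 2) i).target,
        wedgeDensity (chartPartition M i) r y i x
      = ∑ i ∈ activeCharts M, ∑ j ∈ activeCharts M, ∫ x in (extChartAt (𝓡∂ 2) i).target,
        inChart (chartPartition M j) i x * wedgeDensity (chartPartition M i) r y i x := by
        refine Finset.sum_congr rfl fun i _ => ?_
        rw [← integral_finsetSum _ fun j _ => hint1 i j]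
        refine integral_congr_ae (Filter.Eventually.of_forall fun x => ?_)
        simp only [← Finset.sum_mul]
        rw [show ∑ j ∈ activeCharts M, inChart (chartPartition M j) i x = 1 from
          sum_chartPartition _, one_mul]
    _ = ∑ i ∈ activeCharts M, ∑ j ∈ activeCharts M, ∫ x in (extChartAt (𝓡∂ 2) j).target,
        inChart (chartPartition M j) j x * wedgeDensity (chartPartition M i) r y j x :=
        Finset.sum_congr rfl fun i _ => Finset.sum_congr rfl fun j _ =>
          setIntegral_target_wedgeDensity hM (chartPartition M i).contMDiff hr _ i j
            (tsupport_chartPartition_subset i) (tsupport_chartPartition_subset j)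
    _ = ∑ j ∈ activeCharts M, ∫ x in (extChartAt (𝓡∂ 2) j).target,
        ∑ i ∈ activeCharts M,
          inChart (chartPartition M j) j x * wedgeDensity (chartPartition M i) r y j x := by
        rw [Finset.sum_comm]
        exact Finset.sum_congr rfl fun j _ => (integral_finsetSum _ fun i _ => hint2 i j).symm
    _ = 0 := Finset.sum_eq_zero fun j _ => by
        rw [setIntegral_congr_fun (g := fun _ => (0 : ℝ)) (isHalfPlaneOpen_target j).measurableSet,
          integral_zero]
        intro x hx
        simp only [← Finset.mul_sum]
        rw [sum_wedgeDensity_chartPartition r y hx, mul_zero]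

end Partition

/-! ### Differentiation under the integral sign -/

/-- For small `t` all perturbed jets stay in one closed thickening of a compact set, inside the open
set `U`. This gives the dominating constant and also keeps `r + t z` immersed on `K`. -/
theorem exists_thickening_of_isCompact {E : Type*} [NormedAddCommGroup E] [NormedSpace ℝ E]
    {U : Set E} (hU : IsOpen U) {K : Set Plane} (hK : IsCompact K) {A B : Plane → E}
    (hA : ContinuousOn A K) (hB : ContinuousOn B K) (hAU : MapsTo A K U) :
    ∃ ε > 0, ∃ δ > 0, Metric.cthickening δ (A '' K) ⊆ U ∧ ∀ t ∈ Metric.ball (0 : ℝ) ε,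
      ∀ x ∈ K, A x + t • B x ∈ Metric.cthickening δ (A '' K) := by
  obtain ⟨δ, hδ, hδU⟩ := (hK.image_of_continuousOn hA).exists_cthickening_subset_open hU
    hAU.image_subset
  obtain ⟨C, hC⟩ := hK.exists_bound_of_continuousOn hB
  -- Here `|C| + 1` is a positive bound for `B` whatever the sign of `C`.
  refine ⟨δ / (|C| + 1), by positivity, δ, hδ, hδU, fun t ht x hx => ?_⟩
  refine Metric.mem_cthickening_of_dist_le _ (A x) _ _ (mem_image_of_mem A hx) ?_
  rw [dist_eq_norm, add_sub_cancel_left, norm_smul]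
  rw [mem_ball_zero_iff] at ht
  calc ‖t‖ * ‖B x‖ ≤ δ / (|C| + 1) * (|C| + 1) := by
        gcongr
        exact ((hC x hx).trans (le_abs_self C)).trans (by linarith)
    _ = δ := by field_simp

theorem hasDerivAt_setIntegral_comp_line {E : Type*} [NormedAddCommGroup E] [NormedSpace ℝ E]
    [ProperSpace E] {Φ : E → ℝ} {U : Set E} (hU : IsOpen U) (hΦ : ContDiffOn ℝ 1 Φ U)
    {K : Set Plane} (hK : IsCompact K) {A B : Plane → E} {ρ : Plane → ℝ}
    (hρ : ContinuousOn ρ K) (hA : ContinuousOn A K) (hB : ContinuousOn B K) (hAU : MapsTo A K U) :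
    HasDerivAt (fun t : ℝ => ∫ x in K, ρ x * Φ (A x + t • B x))
      (∫ x in K, ρ x * fderiv ℝ Φ (A x) (B x)) 0 := by
  obtain ⟨ε, hε, δ, hδ, hδU, hmem⟩ := exists_thickening_of_isCompact hU hK hA hB hAU
  have hcomp : IsCompact (Metric.cthickening δ (A '' K)) :=
    (hK.image_of_continuousOn hA).cthickening
  have hΦ' := hΦ.continuousOn_fderiv_of_isOpen hU le_rfl
  obtain ⟨C, hC⟩ := hK.exists_bound_of_continuousOn hB
  obtain ⟨R, hR⟩ := hK.exists_bound_of_continuousOn hρ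
  obtain ⟨D, hD⟩ := hcomp.exists_bound_of_continuousOn (hΦ'.mono hδU)
  have hline : ∀ t : ℝ, ContinuousOn (fun x => A x + t • B x) K := fun t =>
    hA.add (continuousOn_const.smul hB)
  have hcont : ∀ t ∈ Metric.ball (0 : ℝ) ε, ContinuousOn (fun x => ρ x * Φ (A x + t • B x)) K :=
    fun t ht => hρ.mul (hΦ.continuousOn.comp (hline t) fun x hx => hδU (hmem t ht x hx))
  have hmain := hasDerivAt_integral_of_dominated_loc_of_deriv_le (μ := volume.restrict K)
    (F := fun t x => ρ x * Φ (A x + t • B x))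
    (F' := fun t x => ρ x * fderiv ℝ Φ (A x + t • B x) (B x)) (x₀ := 0)
    (bound := fun _ => R * (D * C)) (Metric.ball_mem_nhds 0 hε)
    (Filter.mem_of_superset (Metric.ball_mem_nhds 0 hε) fun t ht =>
      (hcont t ht).aestronglyMeasurable hK.measurableSet)
    ((hcont 0 (Metric.mem_ball_self hε)).integrableOn_compact' hK hK.measurableSet)
    ?_ ?_ ?_ ?_
  · simpa using hmain.2
  · refine ContinuousOn.aestronglyMeasurable ?_ hK.measurableSet
    exact hρ.mul ((hΦ'.comp (hline 0)
      fun x hx => hδU (hmem 0 (Metric.mem_ball_self hε) x hx)).clm_apply hB)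
  · filter_upwards [ae_restrict_mem hK.measurableSet] with x hx t ht
    have h1 := hD _ (hmem t ht x hx)
    have h2 := hR x hx
    have h3 := hC x hx
    have h4 := (norm_nonneg _).trans h1
    have h5 := (norm_nonneg _).trans h2
    rw [norm_mul]
    refine mul_le_mul h2 ?_ (norm_nonneg _) h5
    exact (ContinuousLinearMap.le_opNorm _ _).trans (mul_le_mul h1 h3 (norm_nonneg _) h4)
  · exact integrableOn_const hK.measure_lt_top.ne
  · filter_upwards [ae_restrict_mem hK.measurableSet] with x hx t ht
    have hU' := hδU (hmem t ht x hx)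
    have hd := ((hΦ.differentiableOn one_ne_zero).differentiableAt
      (hU.mem_nhds hU')).hasFDerivAt
    have hl : HasDerivAt (fun s : ℝ => A x + s • B x) (B x) t := by
      simpa using ((hasDerivAt_id t).smul_const (B x)).const_add (A x)
    exact (hd.comp_hasDerivAt t hl).const_mul (ρ x)

/-! ### Product rules in the half-plane -/

theorem partialDeriv_apply {φ : Plane → Space} {x : Plane} (hx : x ∈ range (𝓡∂ 2))
    (hφ : DifferentiableWithinAt ℝ φ (range (𝓡∂ 2)) x) (k : Fin 2) (m : Fin 3) :
    partialDeriv k φ x m =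
      fderivWithin ℝ (fun x => φ x m) (range (𝓡∂ 2)) x (EuclideanSpace.single k 1) := by
  rw [((hasFDerivWithinAt_pi'.1 hφ.hasFDerivWithinAt) m).fderivWithin (uniqueDiffOn_halfPlane x hx)]
  rfl

theorem partialDeriv_crossProduct {f g : Plane → Space} {x : Plane} (hx : x ∈ range (𝓡∂ 2))
    (hf : DifferentiableWithinAt ℝ f (range (𝓡∂ 2)) x)
    (hg : DifferentiableWithinAt ℝ g (range (𝓡∂ 2)) x) (k : Fin 2) :
    partialDeriv k (fun x => f x ⨯₃ g x) x =
      partialDeriv k f x ⨯₃ g x + f x ⨯₃ partialDeriv k g x := by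
  have hu := uniqueDiffOn_halfPlane x hx
  have hf' := fun m => (hasFDerivWithinAt_pi'.1 hf.hasFDerivWithinAt) m
  have hg' := fun m => (hasFDerivWithinAt_pi'.1 hg.hasFDerivWithinAt) m
  have hc : ∀ m n : Fin 3, HasFDerivWithinAt (fun x => f x m * g x n - f x n * g x m) _
      (range (𝓡∂ 2)) x := fun m n =>
    ((hf' m).fun_mul (hg' n)).fun_sub ((hf' n).fun_mul (hg' m))
  have hd : DifferentiableWithinAt ℝ (fun x => f x ⨯₃ g x) (range (𝓡∂ 2)) x := by
    refine differentiableWithinAt_pi.2 fun m => ?_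
    fin_cases m <;> simp only [cross_apply]
    · exact (hc 1 2).differentiableWithinAt
    · exact (hc 2 0).differentiableWithinAt
    · exact (hc 0 1).differentiableWithinAt
  ext m
  rw [partialDeriv_apply hx hd]
  fin_cases m <;> simp only [cross_apply]
  · refine (congrArg (fun L : Plane →L[ℝ] ℝ => L _) ((hc 1 2).fderivWithin hu)).trans ?_
    simp [partialDeriv]; ring
  · refine (congrArg (fun L : Plane →L[ℝ] ℝ => L _) ((hc 2 0).fderivWithin hu)).trans ?_
    simp [partialDeriv]; ring
  · refine (congrArg (fun L : Plane →L[ℝ] ℝ => L _) ((hc 0 1).fderivWithin hu)).trans ?_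
    simp [partialDeriv]; ring

theorem fderivWithin_mul_dotProduct {ρ : Plane → ℝ} {f g : Plane → Space} {x : Plane}
    (hx : x ∈ range (𝓡∂ 2)) (hρ : DifferentiableWithinAt ℝ ρ (range (𝓡∂ 2)) x)
    (hf : DifferentiableWithinAt ℝ f (range (𝓡∂ 2)) x)
    (hg : DifferentiableWithinAt ℝ g (range (𝓡∂ 2)) x) (k : Fin 2) :
    fderivWithin ℝ (fun x => ρ x * (f x ⬝ᵥ g x)) (range (𝓡∂ 2)) x (EuclideanSpace.single k 1) =
      fderivWithin ℝ ρ (range (𝓡∂ 2)) x (EuclideanSpace.single k 1) * (f x ⬝ᵥ g x) +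
        ρ x * (partialDeriv k f x ⬝ᵥ g x + f x ⬝ᵥ partialDeriv k g x) := by
  have hu := uniqueDiffOn_halfPlane x hx
  have hf' := fun m => (hasFDerivWithinAt_pi'.1 hf.hasFDerivWithinAt) m
  have hg' := fun m => (hasFDerivWithinAt_pi'.1 hg.hasFDerivWithinAt) m
  have hd : HasFDerivWithinAt (fun x => f x ⬝ᵥ g x) _ (range (𝓡∂ 2)) x :=
    HasFDerivWithinAt.fun_sum fun m (_ : m ∈ Finset.univ) => (hf' m).fun_mul (hg' m)
  rw [(hρ.hasFDerivWithinAt.fun_mul hd).fderivWithin hu]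
  simp [partialDeriv, dotProduct, Fin.sum_univ_three]
  ring

/-! ### Second order jets -/

/-- The first and second partial derivatives. -/
def jet (φ : Plane → Space) (x : Plane) : Fin 6 → Space :=
  ![partialDeriv 0 φ x, partialDeriv 1 φ x, partialDeriv 0 (partialDeriv 0 φ) x,
    partialDeriv 0 (partialDeriv 1 φ) x, partialDeriv 1 (partialDeriv 0 φ) x,
    partialDeriv 1 (partialDeriv 1 φ) x]

/-- `H dA` as a function of the jet. -/
def jetDensity (J : Fin 6 → Space) : ℝ :=
  curvatureDensity (J 0) (J 1) (J 2) (J 3) (J 4) (J 5)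

/-- The jets of immersions. -/
def regularJets : Set (Fin 6 → Space) := {J | J 0 ⨯₃ J 1 ≠ 0}

theorem contDiffOn_jet_apply (k : Fin 6) (s : Set (Fin 6 → Space)) {n : ℕ∞ω} :
    ContDiffOn ℝ n (fun J : Fin 6 → Space => J k) s :=
  (contDiff_apply ℝ Space k).contDiffOn

theorem isOpen_regularJets : IsOpen regularJets := by
  have h := contDiffOn_crossProduct (n := 0) (contDiffOn_jet_apply 0 univ)
    (contDiffOn_jet_apply 1 univ)
  exact isOpen_ne_fun (continuousOn_univ.1 h.continuousOn) continuous_const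

theorem contDiffOn_jetDensity : ContDiffOn ℝ 1 jetDensity regularJets := by
  have h := fun k => contDiffOn_jet_apply k regularJets (n := 1)
  have hN := contDiffOn_crossProduct (h 0) (h 1)
  have hq := (((contDiffOn_dotProduct (h 1) (h 1)).mul (contDiffOn_dotProduct (h 2) hN)).sub
    ((contDiffOn_dotProduct (h 0) (h 1)).mul ((contDiffOn_dotProduct (h 3) hN).add
      (contDiffOn_dotProduct (h 4) hN)))).add
        ((contDiffOn_dotProduct (h 0) (h 0)).mul (contDiffOn_dotProduct (h 5) hN))
  refine hq.div (contDiffOn_const.mul (contDiffOn_dotProduct hN hN)) fun J hJ => ?_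
  exact mul_ne_zero two_ne_zero (dotProduct_self_pos hJ).ne'

theorem continuousOn_jet {T : Set Plane} (hT : IsHalfPlaneOpen T) {φ : Plane → Space}
    (hφ : ContDiffOn ℝ ∞ φ T) : ContinuousOn (jet φ) T := by
  have h1 := fun k => contDiffOn_partialDeriv hT hφ k
  have h2 := fun j k => contDiffOn_partialDeriv hT (h1 k) j
  refine continuousOn_pi.2 fun k => ?_
  fin_cases k
  exacts [(h1 0).continuousOn, (h1 1).continuousOn, (h2 0 0).continuousOn, (h2 0 1).continuousOn,
    (h2 1 0).continuousOn, (h2 1 1).continuousOn]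

theorem partialDeriv_add_smul {T : Set Plane} (hT : IsHalfPlaneOpen T) {φ ψ : Plane → Space}
    (hφ : ContDiffOn ℝ ∞ φ T) (hψ : ContDiffOn ℝ ∞ ψ T) (t : ℝ) {x : Plane} (hx : x ∈ T)
    (k : Fin 2) :
    partialDeriv k (fun x => φ x + t • ψ x) x = partialDeriv k φ x + t • partialDeriv k ψ x := by
  have hu := uniqueDiffOn_halfPlane x (hT.1 hx)
  have h1 := (hT.differentiableWithinAt hφ (by simp) hx).hasFDerivWithinAt
  have h2 := (hT.differentiableWithinAt hψ (by simp) hx).hasFDerivWithinAt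
  rw [partialDeriv, (h1.fun_add (h2.fun_const_smul t)).fderivWithin hu]
  rfl

theorem jet_add_smul {T : Set Plane} (hT : IsHalfPlaneOpen T) {φ ψ : Plane → Space}
    (hφ : ContDiffOn ℝ ∞ φ T) (hψ : ContDiffOn ℝ ∞ ψ T) (t : ℝ) {x : Plane} (hx : x ∈ T) :
    jet (fun x => φ x + t • ψ x) x = jet φ x + t • jet ψ x := by
  have h1 := fun y (hy : y ∈ T) k => partialDeriv_add_smul hT hφ hψ t hy k
  have h2 : ∀ j k, partialDeriv j (partialDeriv k fun x => φ x + t • ψ x) x =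
      partialDeriv j (partialDeriv k φ) x + t • partialDeriv j (partialDeriv k ψ) x := by
    intro j k
    rw [← partialDeriv_add_smul hT (contDiffOn_partialDeriv hT hφ k)
      (contDiffOn_partialDeriv hT hψ k) t hx j, partialDeriv, partialDeriv,
      hT.fderivWithin_congr (fun y hy => h1 y hy k) hx]
  funext m
  fin_cases m
  exacts [h1 x hx 0, h1 x hx 1, h2 0 0, h2 0 1, h2 1 0, h2 1 1]

theorem meanCurvature_mul_areaElement_eq_jetDensity {T : Set Plane} (hT : IsHalfPlaneOpen T)
    {φ : Plane → Space} (hφ : ContDiffOn ℝ ∞ φ T) {x : Plane} (hx : x ∈ T)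
    (h : jet φ x ∈ regularJets) :
    meanCurvature φ x * areaElement φ x = jetDensity (jet φ x) :=
  meanCurvature_mul_areaElement h (partialDeriv_comm hT hφ hx 0 1)

/-! ### The variation in a chart -/

/-- Differentiating `hrot` once more brings the jet of `ψ` to the form treated by
`hasDerivAt_curvatureDensity`; uniqueness of the derivative along the line of jets then identifies
the two values. -/
theorem fderiv_jetDensity_apply {T : Set Plane} (hT : IsHalfPlaneOpen T) {φ ψ η : Plane → Space}
    (hφ : ContDiffOn ℝ ∞ φ T) (hη : ContDiffOn ℝ ∞ η T)
    (hrot : ∀ x ∈ T, ∀ k, partialDeriv k ψ x = η x ⨯₃ partialDeriv k φ x)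
    {x : Plane} (hx : x ∈ T) (h : jet φ x ∈ regularJets) :
    fderiv ℝ jetDensity (jet φ x) (jet ψ x) =
      -(1 / 2) * (partialDeriv 0 η x ⬝ᵥ partialDeriv 1 φ x -
        partialDeriv 1 η x ⬝ᵥ partialDeriv 0 φ x) := by
  have h2 : ∀ j k, partialDeriv j (partialDeriv k ψ) x =
      partialDeriv j η x ⨯₃ partialDeriv k φ x +
        η x ⨯₃ partialDeriv j (partialDeriv k φ) x := by
    intro j k
    rw [← partialDeriv_crossProduct (hT.1 hx) (hT.differentiableWithinAt hη (by simp) hx)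
      (hT.differentiableWithinAt (contDiffOn_partialDeriv hT hφ k) (by simp) hx), partialDeriv,
      partialDeriv, hT.fderivWithin_congr (fun y hy => hrot y hy k) hx]
  have hd := ((contDiffOn_jetDensity.differentiableOn one_ne_zero).differentiableAt
    (isOpen_regularJets.mem_nhds h)).hasFDerivAt
  have hl : HasDerivAt (fun s : ℝ => jet φ x + s • jet ψ x) (jet ψ x) 0 := by
    simpa using ((hasDerivAt_id (0 : ℝ)).smul_const (jet ψ x)).const_add (jet φ x)
  have h3 := hd.comp_hasDerivAt_of_eq (0 : ℝ) hl (by simp)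
  refine h3.unique ?_
  have h4 := hasDerivAt_curvatureDensity (partialDeriv 0 φ x) (partialDeriv 1 φ x)
    (partialDeriv 0 (partialDeriv 0 φ) x) (partialDeriv 0 (partialDeriv 1 φ) x)
    (partialDeriv 1 (partialDeriv 0 φ) x) (partialDeriv 1 (partialDeriv 1 φ) x)
    (η x) (partialDeriv 0 η x) (partialDeriv 1 η x) h
  rw [← hrot x hx 0, ← hrot x hx 1, ← h2, ← h2, ← h2, ← h2] at h4
  exact h4

theorem hasDerivAt_setIntegral_meanCurvature {T K : Set Plane} (hT : IsHalfPlaneOpen T)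
    (hK : IsCompact K) (hKT : K ⊆ T) {φ ψ η : Plane → Space} {ρ : Plane → ℝ}
    (hφ : ContDiffOn ℝ ∞ φ T) (hψ : ContDiffOn ℝ ∞ ψ T) (hη : ContDiffOn ℝ ∞ η T)
    (hρ : ContinuousOn ρ T) (h0 : ∀ x ∈ T, x ∉ K → ρ x = 0)
    (hrot : ∀ x ∈ T, ∀ k, partialDeriv k ψ x = η x ⨯₃ partialDeriv k φ x)
    (himm : ∀ x ∈ T, normalVec φ x ≠ 0) :
    HasDerivAt (fun t : ℝ => ∫ x in T, ρ x * (meanCurvature (fun x => φ x + t • ψ x) x *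
        areaElement (fun x => φ x + t • ψ x) x))
      (∫ x in T, -(1 / 2) * (ρ x * (partialDeriv 0 η x ⬝ᵥ partialDeriv 1 φ x -
        partialDeriv 1 η x ⬝ᵥ partialDeriv 0 φ x))) 0 := by
  have hA := (continuousOn_jet hT hφ).mono hKT
  have hB := (continuousOn_jet hT hψ).mono hKT
  have hAU : MapsTo (jet φ) K regularJets := fun x hx => himm x (hKT hx)
  have hTK : ∀ g : Plane → ℝ, (∀ x ∈ T, x ∉ K → g x = 0) → ∫ x in T, g x = ∫ x in K, g x :=
    fun g hg => setIntegral_eq_of_subset_of_forall_sdiff_eq_zero hT.measurableSet hKT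
      fun x hx => hg x hx.1 hx.2
  have hφψ : ∀ t : ℝ, ContDiffOn ℝ ∞ (fun x => φ x + t • ψ x) T := fun t =>
    hφ.add (contDiffOn_const (c := t) |>.smul hψ)
  have hmain := hasDerivAt_setIntegral_comp_line isOpen_regularJets contDiffOn_jetDensity hK
    (hρ.mono hKT) hA hB hAU
  obtain ⟨ε, hε, δ, hδ, hδU, hmem⟩ := exists_thickening_of_isCompact isOpen_regularJets hK hA hB hAU
  refine (hmain.congr_of_eventuallyEq ?_).congr_deriv ?_
  -- The rational formula for `H dS` is available only at immersions, so the two functions of `t`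
  -- are identified only near `0`.
  · filter_upwards [Metric.ball_mem_nhds 0 hε] with t ht
    rw [hTK _ fun x hx hxK => by rw [h0 x hx hxK, zero_mul]]
    refine setIntegral_congr_fun hK.measurableSet fun x hx => ?_
    have hj := jet_add_smul hT hφ hψ t (hKT hx)
    have hreg := hδU (hmem t ht x hx)
    rw [← hj] at hreg
    have hm := meanCurvature_mul_areaElement_eq_jetDensity hT (hφψ t) (hKT hx) hreg
    rw [hj] at hm
    exact congrArg (ρ x * ·) hm
  · rw [hTK _ fun x hx hxK => by rw [h0 x hx hxK]; simp]
    refine setIntegral_congr_fun hK.measurableSet fun x hx => ?_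
    rw [fderiv_jetDensity_apply hT hφ hη hrot (hKT hx) (hAU hx)]
    ring

/-- Leibniz rule `ρ d(η · dφ) = d(ρ η · dφ) - dρ ∧ (η · dφ)`: the mixed second derivatives of `φ`
cancel, and Stokes handles the exact term. -/
theorem setIntegral_mul_curl {T K : Set Plane} (hT : IsHalfPlaneOpen T)
    (hK : IsCompact K) (hKT : K ⊆ T) {φ η : Plane → Space} {ρ : Plane → ℝ}
    (hφ : ContDiffOn ℝ ∞ φ T) (hη : ContDiffOn ℝ ∞ η T)
    (hρ : ContDiffOn ℝ ∞ ρ T) (h0 : ∀ x ∈ T, x ∉ K → ρ x = 0) :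
    ∫ x in T, ρ x * (partialDeriv 0 η x ⬝ᵥ partialDeriv 1 φ x -
        partialDeriv 1 η x ⬝ᵥ partialDeriv 0 φ x) =
      (-∫ v in {v : ℝ | !₂[0, v] ∈ T}, ρ !₂[0, v] * (η !₂[0, v] ⬝ᵥ partialDeriv 1 φ !₂[0, v])) -
        ∫ x in T, wedge (fderivWithin ℝ ρ (range (𝓡∂ 2)) x) (η x)
          (fderivWithin ℝ φ (range (𝓡∂ 2)) x) := by
  have hd := fun k => contDiffOn_partialDeriv hT hφ k
  have hh : ∀ k, ContDiffOn ℝ 1 (fun x => ρ x * (η x ⬝ᵥ partialDeriv k φ x)) T := fun k =>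
    (hρ.mul (contDiffOn_dotProduct hη (hd k))).of_le (by simp)
  have hh0 : ∀ k, ∀ x ∈ T, x ∉ K → ρ x * (η x ⬝ᵥ partialDeriv k φ x) = 0 := fun k x hx hxK => by
    rw [h0 x hx hxK, zero_mul]
  have hi0 := integrableOn_target_fderivWithin_apply hT hK hKT (hh 1) (hh0 1)
    (EuclideanSpace.single 0 1)
  have hi1 := integrableOn_target_fderivWithin_apply hT hK hKT (hh 0) (hh0 0)
    (EuclideanSpace.single 1 1)
  have hcurl : IntegrableOn (fun x => ρ x * (partialDeriv 0 η x ⬝ᵥ partialDeriv 1 φ x -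
        partialDeriv 1 η x ⬝ᵥ partialDeriv 0 φ x)) T := by
    refine integrableOn_of_continuousOn_of_compl hK hT.measurableSet ?_ fun x hx hxK => by
      rw [h0 x hx hxK, zero_mul]
    have he := fun k => contDiffOn_partialDeriv hT hη k
    exact ((hρ.mul ((contDiffOn_dotProduct (he 0) (hd 1)).sub
      (contDiffOn_dotProduct (he 1) (hd 0)))).continuousOn).mono hKT
  have hi : IntegrableOn (fun x =>
      fderivWithin ℝ (fun x => ρ x * (η x ⬝ᵥ partialDeriv 1 φ x)) (range (𝓡∂ 2)) x
        (EuclideanSpace.single 0 1) -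
      fderivWithin ℝ (fun x => ρ x * (η x ⬝ᵥ partialDeriv 0 φ x)) (range (𝓡∂ 2)) x
        (EuclideanSpace.single 1 1)) T := hi0.sub hi1
  -- The boundary term becomes a `u`-derivative integral, and a subtracted `0` becomes the
  -- `v`-derivative integral, completing the exact form under one integral.
  rw [← setIntegral_fderivWithin_fst hT hK hKT (hh 1) (hh0 1), eq_sub_iff_add_eq,
    ← sub_zero (∫ x in T, fderivWithin ℝ (fun x => ρ x * (η x ⬝ᵥ partialDeriv 1 φ x)) _ x _),
    ← setIntegral_fderivWithin_snd hT hK hKT (hh 0) (hh0 0), ← integral_sub hi0 hi1,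
    ← eq_sub_iff_add_eq', ← integral_sub hi hcurl]
  refine setIntegral_congr_fun hT.measurableSet fun x hx => ?_
  have hρx := hT.differentiableWithinAt hρ (by simp) hx
  have hηx := hT.differentiableWithinAt hη (by simp) hx
  have hdx := fun k => hT.differentiableWithinAt (hd k) (by simp) hx
  rw [fderivWithin_mul_dotProduct (hT.1 hx) hρx hηx (hdx 1),
    fderivWithin_mul_dotProduct (hT.1 hx) hρx hηx (hdx 0), partialDeriv_comm hT hφ hx 0 1, wedge]
  simp only [partialDeriv]
  ring

end SurfaceBending

end

/-! ### The variation formula -/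

theorem theorem2 {M : Type*} [TopologicalSpace M] [T2Space M] [CompactSpace M]
    [ChartedSpace (EuclideanHalfSpace 2) M] [IsManifold (𝓡∂ 2) ∞ M]
    (hM : SurfaceBending.IsOrientedAtlas M)
    (r z y : M → SurfaceBending.Space)
    (hr : SurfaceBending.IsSmoothImmersion r)
    (hz : SurfaceBending.IsInfinitesimalBending r z)
    (hy : SurfaceBending.IsRotationField r z y) :
    HasDerivAt (fun t : ℝ => SurfaceBending.totalMeanCurvature (fun p => r p + t • z p))
      (-(1 / 2) * SurfaceBending.boundaryLineIntegral r y) 0 := by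
  open SurfaceBending in
  have hφ := fun i => contDiffOn_inChart hr.1 i
  have hη := fun i => contDiffOn_inChart_rotation hr hz.1 hy i
  have hρ := fun i : M => contDiffOn_inChart (chartPartition M i).contMDiff i
  -- All but finitely many weights vanish identically, so both `finsum`s become sums over
  -- `activeCharts M`, which can be differentiated termwise.
  have hzero : ∀ i : M, i ∉ activeCharts M → ∀ x, inChart (chartPartition M i) i x = 0 :=
    fun i hi x => chartPartition_eq_zero hi _
  have hH : (fun t : ℝ => totalMeanCurvature (fun p => r p + t • z p)) = fun t =>
      ∑ i ∈ activeCharts M, ∫ x in (extChartAt (𝓡∂ 2) i).target,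
        inChart (chartPartition M i) i x *
          (meanCurvature (fun x => inChart r i x + t • inChart z i x) x *
            areaElement (fun x => inChart r i x + t • inChart z i x) x) := by
    funext t
    refine finsum_eq_sum_of_support_subset _ fun i hi => ?_
    by_contra h
    exact hi (by simp [hzero i h])
  have hL : boundaryLineIntegral r y = ∑ i ∈ activeCharts M,
      -∫ v in {v : ℝ | !₂[0, v] ∈ (extChartAt (𝓡∂ 2) i).target},
        inChart (chartPartition M i) i !₂[0, v] *
          (inChart y i !₂[0, v] ⬝ᵥ partialDeriv 1 (inChart r i) !₂[0, v]) := by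
    refine finsum_eq_sum_of_support_subset _ fun i hi => ?_
    by_contra h
    exact hi (by simp [hzero i h])
  rw [hH, hL]
  refine (HasDerivAt.fun_sum fun i _ => hasDerivAt_setIntegral_meanCurvature
    (isHalfPlaneOpen_target i) (isCompact_chartSupport i) (chartSupport_subset i) (hφ i)
    (contDiffOn_inChart hz.1 i) (hη i) (hρ i).continuousOn
    (fun x hx hxK => inChart_chartPartition_eq_zero hx hxK)
    (fun x hx k => partialDeriv_inChart_rotation hr.1 hz.1 hy i hx k)
    (fun x hx => normalVec_inChart_ne_zero hr i hx)).congr_deriv ?_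
  simp only [integral_const_mul]
  rw [← Finset.mul_sum]
  congr 1
  rw [Finset.sum_congr rfl fun i _ => setIntegral_mul_curl (isHalfPlaneOpen_target i)
    (isCompact_chartSupport i) (chartSupport_subset i) (hφ i) (hη i) (hρ i)
    (fun x hx hxK => inChart_chartPartition_eq_zero hx hxK), Finset.sum_sub_distrib]
  -- The correction terms left by the weights cancel globally, and the boundary terms alone remain.
  have hw := sum_setIntegral_wedgeDensity hM hr.1 hη
  simp only [wedgeDensity] at hw
  rw [hw, sub_zero]
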